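/- Let $k\ge 2$, let $(\xi_i)_{i\in I}$ be a (finite or infinite) family of independent standard normal random variables, and let $$Z_k=\sum a(n_1,\dots,n_k)\,:\!\xi_{n_1}\cdots\xi_{n_k}\!:$$ be a Wick polynomial with real coefficients $a(n_1,\dots,n_k)$, $n_1,\dots,n_k\in I$, only finitely many of which are non-zero (no symmetry of $a$ is assumed). Here, if the distinct indices among $n_1,\dots,n_k$ are $j_1,\dots,j_r$ with multiplicities $l_1,\dots,l_r$, then $:\!\xi_{n_1}\cdots\xi_{n_k}\!:\;=H_{l_1}(\xi_{j_1})\cdots H_{l_r}(\xi_{j_r})$, where $H_l$ is the (probabilists') Hermite polynomial of order $l$ with leading coefficient $1$. For a partition $P=\{A_1,\dots,A_s\}$ of $\{1,\dots,k\}$ into non-empty sets put $$\bar V_P(a)=\sup\ \sum_{n_1,\dots,n_k} a(n_1,\dots,n_k)\prod_{r=1}^s b_r(n_j,\ j\in A_r),$$ the supremum being taken over all real arrays $b_1,\dots,b_s$ with $\sum b_r^2(n_j,\ j\in A_r)\le 1$ for $1\le r\le s$, and let $\bar V_s=\bar V_s(a)$ be the maximum of $\bar V_P(a)$ over all partitions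 $P$ of $\{1,\dots,k\}$ into exactly $s$ sets, $1\le s\le k$. There exist constants $C,C_1,C_2>0$ depending only on $k$ such that, for all such families $(\xi_i)$ and all such $a$ (with the bounds read as $Z_k=0$ if $a=0$), $$E Z_k^{2M}\le C^M\,\bar V_1^{2M}\max\Bigl(M,\ M^k\max_{2\le s\le k}\Bigl(\frac{\bar V_s}{\bar V_1}\Bigr)^{2/(s-1)}\Bigr)^M\qquad\text{for all } M=1,2,\dots$$ (in particular these moments are finite), and $$P(|Z_k|>x)\le C_1\exp\Bigl\{-C_2\min\Bigl(\frac{x^2}{\bar V_1^2},\ \min_{2\le s\le k}\Bigl(\frac{x}{\bar V_1^{(s-2)/(s-1)}\,\bar V_s^{1/(s-1)}}\Bigr)^{2/k}\Bigr)\Bigr\}\qquad\text{for all } x>0.$$ For $k=2$ this recovers the Hanson--Wright inequality: if $A=(a(i,j))$ is a symmetric real $n\times n$ matrix and $\xi_1,\dots,\xi_n$ are independent standard normal random variables, then $S_n=\sum_{i,j=1}^n a(i,j)(\xi_i\xi_j-E\xi_i\xi_j)$ is equal to the polynomial $Z_2$ with coefficients $a(i,j)$, one has $\bar V_1(a)^2=\Lambda^2:=\sum_{i,j}a(i,j)^2$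 and $\bar V_2(a)=\|A\|:=\sup_{|v|=1}|Av|$ (read as $0$ if $n=0$), and there are universal constants $C_1,C_2>0$ such that $$P(S_n>x)\le C_1\exp\Bigl\{-\min\Bigl(\frac{C_2x}{\|A\|},\frac{C_2x^2}{\Lambda^2}\Bigr)\Bigr\}\qquad\text{for all } x>0$$ (the right-hand side plays no role when $A=0$, since then $S_n=0$). -/

import Mathlib

open MeasureTheory ProbabilityTheory

noncomputable section

namespace GaussianPolynomial

/-- The Wick monomial `:ξ_{n_1} ⋯ ξ_{n_k}:`, that is, the product over the distinct indices `j`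
occurring in `n` of `H_l(ξ_j)`, where `l` is the multiplicity of `j` in `n` and `H_l` is the
Hermite polynomial of order `l` with leading coefficient `1`. -/
def wickMonomial {Ω ι : Type*} [DecidableEq ι] {k : ℕ} (ξ : ι → Ω → ℝ) (n : Fin k → ι)
    (ω : Ω) : ℝ :=
  ∏ j ∈ Finset.univ.image n,
    Polynomial.aeval (ξ j ω) (Polynomial.hermite (Finset.univ.filter fun i => n i = j).card)

/-- The random polynomial `Z_k = ∑ a(n_1, …, n_k) :ξ_{n_1} ⋯ ξ_{n_k}:` (a finite sum). -/
def wickPolynomial {Ω ι : Type*} [DecidableEq ι] {k : ℕ} (ξ : ι → Ω → ℝ)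
    (a : (Fin k → ι) →₀ ℝ) (ω : Ω) : ℝ :=
  a.sum fun n c => c * wickMonomial ξ n ω

/-- The class `𝒢_P` of families of real arrays `b_A(n_j, j ∈ A)`, one for every block `A` of the
partition `P` of `{1, …, k}`, such that the sum of the squares of each array is at most `1`. -/
def testFamilies (ι : Type*) {k : ℕ} (P : Finpartition (Finset.univ : Finset (Fin k))) :
    Set ((A : P.parts) → ((A.1 → ι) → ℝ)) :=
  {b | ∀ A, Summable (fun m => b A m ^ 2) ∧ ∑' m, b A m ^ 2 ≤ 1}

/-- `V̄_P(a) = sup ∑ a(n_1, …, n_k) ∏_{A ∈ P} b_A(n_j, j ∈ A)`, the supremum over `b ∈ 𝒢_P`.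
The arrays in `𝒢_P` are bounded by `1` and `a` has finite support, so the set is bounded. -/
def VPart {ι : Type*} {k : ℕ} (a : (Fin k → ι) →₀ ℝ)
    (P : Finpartition (Finset.univ : Finset (Fin k))) : ℝ :=
  sSup ((fun b : (A : P.parts) → ((A.1 → ι) → ℝ) =>
    a.sum fun n c => c * ∏ A : P.parts, b A fun j => n j) '' testFamilies ι P)

/-- `V̄_s(a)`, the supremum of `V̄_P(a)` over the partitions `P` of `{1, …, k}` into exactly `s`
nonempty blocks. -/
def V {ι : Type*} {k : ℕ} (s : ℕ) (a : (Fin k → ι) →₀ ℝ) : ℝ :=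
  ⨆ P : {P : Finpartition (Finset.univ : Finset (Fin k)) // P.parts.card = s}, VPart a P.1

/-- An `n × n` matrix as an array of coefficients with two indices. -/
def matrixCoeff {n : ℕ} (A : Matrix (Fin n) (Fin n) ℝ) : (Fin 2 → Fin n) →₀ ℝ :=
  Finsupp.equivFunOnFinite.symm fun p => A (p 0) (p 1)

/-- `S_n = ∑_{i,j} A(i,j) (ξ_i ξ_j - E ξ_i ξ_j)`. -/
def centeredForm {Ω : Type*} [MeasurableSpace Ω] (μ : Measure Ω) {n : ℕ} (ξ : Fin n → Ω → ℝ)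
    (A : Matrix (Fin n) (Fin n) ℝ) (ω : Ω) : ℝ :=
  ∑ i, ∑ j, A i j * (ξ i ω * ξ j ω - ∫ ω', ξ i ω' * ξ j ω' ∂μ)

end GaussianPolynomial

end

noncomputable section

namespace GaussianPolynomial

open MvPolynomial

/-! ### The Wick ordering of polynomials -/

/-! Write `Z` as the Wick ordering of the homogeneous polynomial with coefficient tensor `a`, and
pick `θ` with `V̄_s ≤ V̄_1 θ^(s-1)` for `2 ≤ s ≤ k`. Only this consequence of the `V̄_s`, abstracted
as `TBound`, enters the moment estimate.

The class is stable under contraction over at least one leg (`TBound.contract`): bounds `A` and `B`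
give `θAB`. Suppose the free legs form `s` blocks, `r` of which meet the second tensor. Summing that
tensor against these `r` arrays leaves an array whose `ℓ²` norm is at most `B θ^r` by duality. This
array is one block for the first tensor, next to the `s - r` other blocks, so the form is at most `A
θ^(s-r) · B θ^r = (θAB) θ^(s-1)`.

The moment `E Z^(2M)` is a sum over pairing diagrams, explored one factor at a time. Integration by
parts pairs a leg of the accumulated factor `f` with a leg of one of the remaining copies of `Z`,
and the product formula `wick_mul_wick` merges the two (`expect_wick_mul_pow_succ`). A merge
multiplies the tensor bound by `θA`. When `f` has no legs left, a component is complete: the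
constant costs `1/θ`, and a fresh copy starts the next component. The numbers of choices are
absorbed by the potential `growth` with `s = √M`, so that a merge costs a constant times `s^k θ A`;
the condition `M ≤ M^k θ²` makes a restart no more expensive. This yields `C^M A^(2M) (M^k θ²)^M`
(`abs_expect_wick_mul_pow_le`, `expect_wick_pow_le`), and the best `θ` gives the stated maximum.

The tail follows from Markov's inequality with an optimal `M`. For matrices, `V̄_1` is the
Hilbert–Schmidt norm and `V̄_2` the operator norm, which gives Hanson–Wright. -/

theorem derivative_hermite_succ (n : ℕ) :
    Polynomial.derivative (Polynomial.hermite (n + 1)) = (n + 1 : ℕ) * Polynomial.hermite n := by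
  induction n with
  | zero => simp
  | succ n ih =>
    rw [Polynomial.hermite_succ (n + 1), Polynomial.derivative_sub, Polynomial.derivative_mul, ih,
      Polynomial.hermite_succ n]
    simp only [Polynomial.derivative_X, Polynomial.derivative_mul, Polynomial.derivative_natCast]
    push_cast
    ring

section Wick

variable {σ : Type*}

/-- The Hermite polynomial of order `l` in the variable `j`. -/
def hermiteX (j : σ) (l : ℕ) : MvPolynomial σ ℝ := Polynomial.aeval (X j) (Polynomial.hermite l)

theorem pderiv_aeval_X_self (i : σ) (p : Polynomial ℤ) :
    pderiv i (Polynomial.aeval (X i : MvPolynomial σ ℝ) p) =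
      Polynomial.aeval (X i) (Polynomial.derivative p) := by
  induction p using Polynomial.induction_on' with
  | add p q hp hq => simp only [map_add, hp, hq]
  | monomial n a =>
    rw [Polynomial.aeval_monomial, Polynomial.derivative_monomial, Polynomial.aeval_monomial,
      Derivation.leibniz, pderiv_pow, pderiv_X_self]
    simp
    ring

theorem pderiv_aeval_X_of_ne {i j : σ} (h : j ≠ i) (p : Polynomial ℤ) :
    pderiv i (Polynomial.aeval (X j : MvPolynomial σ ℝ) p) = 0 := by
  induction p using Polynomial.induction_on' with
  | add p q hp hq => simp only [map_add, hp, hq, add_zero]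
  | monomial n a =>
    rw [Polynomial.aeval_monomial, Derivation.leibniz, pderiv_pow, pderiv_X_of_ne h]
    simp

theorem pderiv_hermiteX_self (i : σ) (l : ℕ) :
    pderiv i (hermiteX i l) = (l : MvPolynomial σ ℝ) * hermiteX i (l - 1) := by
  cases l with
  | zero => simp [hermiteX]
  | succ l =>
    rw [hermiteX, pderiv_aeval_X_self, derivative_hermite_succ, map_mul, map_natCast]
    rfl

theorem hermiteX_succ (i : σ) (l : ℕ) :
    hermiteX i (l + 1) = X i * hermiteX i l - pderiv i (hermiteX i l) := by
  rw [hermiteX, hermiteX, pderiv_aeval_X_self, Polynomial.hermite_succ, map_sub, map_mul,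
    Polynomial.aeval_X]

theorem pderiv_prod_hermiteX (i : σ) (s : σ → ℕ) (t : Finset σ) (hi : i ∉ t) :
    pderiv i (∏ j ∈ t, hermiteX j (s j)) = 0 := by
  classical
  induction t using Finset.induction_on with
  | empty => simp
  | insert j t hj ih =>
    rw [Finset.mem_insert, not_or] at hi
    rw [Finset.prod_insert hj, Derivation.leibniz, ih hi.2, hermiteX,
      pderiv_aeval_X_of_ne (Ne.symm hi.1), smul_zero, smul_zero, add_zero]

theorem pderiv_comm (i j : σ) (f : MvPolynomial σ ℝ) :
    pderiv i (pderiv j f) = pderiv j (pderiv i f) := by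
  classical
  have h : ⁅pderiv (R := ℝ) i, pderiv j⁆ = 0 := derivation_ext fun l => by
    rw [Derivation.commutator_apply, pderiv_X, pderiv_X, Pi.single_apply, Pi.single_apply]
    split_ifs <;> simp
  have := DFunLike.congr_fun h f
  rwa [Derivation.commutator_apply, Derivation.zero_apply, sub_eq_zero] at this

variable [Fintype σ]

/-- Wick ordering: the linear map that sends a monomial `∏ X_j ^ s_j` to `∏ H_{s_j}(X_j)`. -/
def wick : MvPolynomial σ ℝ →ₗ[ℝ] MvPolynomial σ ℝ :=
  (basisMonomials σ ℝ).constr ℝ fun s => ∏ j, hermiteX j (s j)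

theorem wick_monomial (s : σ →₀ ℕ) (r : ℝ) :
    wick (monomial s r) = r • ∏ j, hermiteX j (s j) := by
  have h : monomial s r = r • basisMonomials σ ℝ s := by simp [smul_monomial]
  rw [h, map_smul, wick, Module.Basis.constr_basis]

theorem wick_C (r : ℝ) : wick (C r : MvPolynomial σ ℝ) = C r := by
  have : (C r : MvPolynomial σ ℝ) = monomial 0 r := rfl
  rw [this, wick_monomial]
  simp only [Finsupp.coe_zero, Pi.zero_apply, hermiteX, Polynomial.hermite_zero, map_one,
    Finset.prod_const_one]
  rw [← this, smul_eq_C_mul, mul_one]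

/-- Hermite polynomials obey `H_l' = l H_(l-1)`, the rule for powers, so Wick ordering does not
affect differentiation. -/
theorem pderiv_wick (i : σ) (f : MvPolynomial σ ℝ) :
    pderiv i (wick f) = wick (pderiv i f) := by
  classical
  induction f using MvPolynomial.induction_on' with
  | add f g hf hg => simp only [map_add, hf, hg]
  | monomial s r =>
    have hp : ∏ x ∈ Finset.univ.erase i, hermiteX x ((s - Finsupp.single i 1 : σ →₀ ℕ) x) =
        ∏ x ∈ Finset.univ.erase i, hermiteX x (s x) := Finset.prod_congr rfl fun j hj => by
      rw [Finsupp.coe_tsub, Pi.sub_apply, Finsupp.single_eq_of_ne (Finset.ne_of_mem_erase hj),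
        Nat.sub_zero]
    rw [pderiv_monomial, wick_monomial, wick_monomial, Derivation.map_smul,
      ← Finset.mul_prod_erase _ _ (Finset.mem_univ i),
      ← Finset.mul_prod_erase _ _ (Finset.mem_univ i), Derivation.leibniz,
      pderiv_prod_hermiteX _ _ _ (Finset.notMem_erase _ _), pderiv_hermiteX_self, mul_smul, hp,
      smul_zero, zero_add, ← map_natCast (C : ℝ →+* MvPolynomial σ ℝ), smul_eq_mul,
      Finsupp.coe_tsub, Pi.sub_apply, Finsupp.single_eq_same, ← smul_eq_C_mul, mul_smul_comm,
      mul_comm]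

/-- This is the recursion `H_(l+1) = x H_l - H_l'` in several variables. It drives both the product
formula and integration by parts. -/
theorem wick_X_mul (i : σ) (f : MvPolynomial σ ℝ) :
    wick (X i * f) = X i * wick f - wick (pderiv i f) := by
  classical
  rw [← pderiv_wick]
  induction f using MvPolynomial.induction_on' with
  | add f g hf hg => rw [mul_add, map_add, hf, hg, map_add, map_add]; ring
  | monomial s r =>
    have h : X i * monomial s r = monomial (Finsupp.single i 1 + s) r := by
      rw [X, monomial_mul, one_mul]
    rw [h, wick_monomial, wick_monomial, Derivation.map_smul, mul_smul_comm, ← smul_sub,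
      ← Finset.mul_prod_erase _ _ (Finset.mem_univ i),
      ← Finset.mul_prod_erase _ (fun j => hermiteX j (s j)) (Finset.mem_univ i),
      Derivation.leibniz, pderiv_prod_hermiteX _ _ _ (Finset.notMem_erase _ _),
      Finset.prod_congr rfl (g := fun j => hermiteX j (s j)) (fun j hj => by
        rw [Finsupp.add_apply, Finsupp.single_eq_of_ne (Finset.ne_of_mem_erase hj), zero_add])]
    rw [Finsupp.add_apply, Finsupp.single_eq_same, add_comm 1, hermiteX_succ, smul_zero,
      zero_add, smul_eq_mul]
    congr 1
    ring

/-! ### Iterated contractions and the product formula -/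

/-- `contr q f g` is the sum over `i_1, …, i_q` of the products of `∂_{i_1} ⋯ ∂_{i_q} f` and
`∂_{i_1} ⋯ ∂_{i_q} g`. -/
def contr : ℕ → MvPolynomial σ ℝ → MvPolynomial σ ℝ → MvPolynomial σ ℝ
  | 0, f, g => f * g
  | q + 1, f, g => ∑ i, contr q (pderiv i f) (pderiv i g)

theorem contr_add_left (q : ℕ) (f f' g : MvPolynomial σ ℝ) :
    contr q (f + f') g = contr q f g + contr q f' g := by
  induction q generalizing f f' g with
  | zero => simp [contr, add_mul]
  | succ q ih => simp [contr, ih, Finset.sum_add_distrib]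

theorem contr_add_right (q : ℕ) (f g g' : MvPolynomial σ ℝ) :
    contr q f (g + g') = contr q f g + contr q f g' := by
  induction q generalizing f g g' with
  | zero => simp [contr, mul_add]
  | succ q ih => simp [contr, ih, Finset.sum_add_distrib]

theorem contr_zero_left (q : ℕ) (g : MvPolynomial σ ℝ) : contr q 0 g = 0 := by
  simpa using contr_add_left q 0 0 g

theorem contr_zero_right (q : ℕ) (f : MvPolynomial σ ℝ) : contr q f 0 = 0 := by
  simpa using contr_add_right q f 0 0

theorem contr_sum_left {α : Type*} (s : Finset α) (q : ℕ) (f : α → MvPolynomial σ ℝ)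
    (g : MvPolynomial σ ℝ) : contr q (∑ x ∈ s, f x) g = ∑ x ∈ s, contr q (f x) g := by
  classical
  induction s using Finset.induction_on with
  | empty => simp [contr_zero_left]
  | insert x s hx ih => rw [Finset.sum_insert hx, Finset.sum_insert hx, contr_add_left, ih]

theorem contr_sum_right {α : Type*} (s : Finset α) (q : ℕ) (f : MvPolynomial σ ℝ)
    (g : α → MvPolynomial σ ℝ) : contr q f (∑ x ∈ s, g x) = ∑ x ∈ s, contr q f (g x) := by
  classical
  induction s using Finset.induction_on with
  | empty => simp [contr_zero_right]
  | insert x s hx ih => rw [Finset.sum_insert hx, Finset.sum_insert hx, contr_add_right, ih]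

theorem contr_smul_left (q : ℕ) (c : ℝ) (f g : MvPolynomial σ ℝ) :
    contr q (c • f) g = c • contr q f g := by
  induction q generalizing f g with
  | zero => simp [contr]
  | succ q ih => simp [contr, ih, Finset.smul_sum]

/-- Leibniz rule: the extra variable stays free or absorbs one of the `q` contractions, and
derivatives commute, so all `q` choices agree. For `q = 0` the truncated `q - 1` has coefficient
zero. -/
theorem contr_X_mul (q : ℕ) (i : σ) (f g : MvPolynomial σ ℝ) :
    contr q (X i * f) g = X i * contr q f g + (q : ℝ) • contr (q - 1) f (pderiv i g) := by
  classical
  induction q generalizing f g with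
  | zero => simp [contr, mul_assoc]
  | succ q ih =>
    have h : ∀ j : σ, pderiv j (X i * f) = X i * pderiv j f + if j = i then f else 0 := by
      intro j
      rw [Derivation.leibniz, pderiv_X, Pi.single_apply]
      split_ifs with h1 h2 h2
      · simp
      · exact absurd h1.symm h2
      · exact absurd h2.symm h1
      · simp
    have h2 : ∀ j : σ, contr q (if j = i then f else 0) (pderiv j g) =
        if j = i then contr q f (pderiv i g) else 0 := by
      intro j
      split_ifs with hj
      · rw [hj]
      · exact contr_zero_left _ _
    simp only [contr, h, contr_add_left, ih, h2, Finset.sum_add_distrib, Finset.sum_ite_eq',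
      Finset.mem_univ, if_true, Finset.mul_sum, Nat.add_sub_cancel]
    rw [add_assoc, ← Finset.smul_sum]
    congr 1
    cases q with
    | zero => simp [contr]
    | succ q =>
      simp only [Nat.add_sub_cancel, contr]
      rw [Finset.sum_congr rfl fun j _ => by rw [pderiv_comm i j g]]
      push_cast
      module

theorem contr_comm (q : ℕ) (f g : MvPolynomial σ ℝ) : contr q f g = contr q g f := by
  induction q generalizing f g with
  | zero => simp [contr, mul_comm]
  | succ q ih => simp only [contr, ih]

theorem contr_prod_X_eq_zero {α : Type*} (s : Finset α) (n : α → σ) (q : ℕ) (hq : s.card < q)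
    (f : MvPolynomial σ ℝ) : contr q f (∏ l ∈ s, X (n l)) = 0 := by
  classical
  induction s using Finset.induction_on generalizing q f with
  | empty =>
    obtain ⟨q, rfl⟩ := Nat.exists_eq_succ_of_ne_zero (Nat.ne_of_gt (lt_of_le_of_lt (Nat.zero_le _) hq))
    simp [contr, contr_zero_right]
  | insert a s ha ih =>
    rw [Finset.card_insert_of_notMem ha] at hq
    rw [Finset.prod_insert ha, contr_comm, contr_X_mul, contr_comm, ih _ (by omega), contr_comm,
      ih _ (by omega)]
    simp

/-- Induction on `f`, multiplying by one variable at a time: `wick_X_mul` on one side matches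
`contr_X_mul` on the other. The vanishing hypothesis makes the sum over `q` finite. -/
theorem wick_mul_wick (Q : ℕ) (f g : MvPolynomial σ ℝ) (hg : ∀ q, Q ≤ q → ∀ f, contr q f g = 0) :
    wick f * wick g = wick (∑ q ∈ Finset.range Q, ((q.factorial : ℝ)⁻¹) • contr q f g) := by
  -- In `contr_X_mul` at order `q + 1` both contractions with `g` vanish, leaving `(q + 1) • contr q
  -- f (∂_i g) = 0`: a derivative lowers the vanishing order by one.
  have hpd : ∀ {g : MvPolynomial σ ℝ}, (∀ q, Q ≤ q → ∀ f, contr q f g = 0) → ∀ i q, Q ≤ q + 1 →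
      ∀ f, contr q f (pderiv i g) = 0 := by
    intro g hg i q hq f
    have h := contr_X_mul (q + 1) i f g
    rw [hg _ hq, hg _ hq, mul_zero, zero_add, Nat.add_sub_cancel, eq_comm, smul_eq_zero] at h
    exact h.resolve_left (by positivity)
  induction f using MvPolynomial.induction_on generalizing g with
  | C a =>
    have hC : ∀ q, contr q (C a) g = if q = 0 then C a * g else 0 := by
      rintro (_ | q) <;> simp [contr, contr_zero_left]
    rcases Nat.eq_zero_or_pos Q with rfl | hQ
    · have : g = 0 := by simpa [contr] using hg 0 le_rfl 1
      simp [this]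
    · simp only [hC, smul_ite, smul_zero, Finset.sum_ite_eq', Finset.mem_range, hQ, if_true]
      simp [wick_C, ← smul_eq_C_mul]
  | add f f' hf hf' =>
    rw [map_add, add_mul, hf g hg, hf' g hg, ← map_add, ← Finset.sum_add_distrib]
    simp only [contr_add_left, smul_add]
  | mul_X f i ih =>
    have h2 := ih (pderiv i g) fun q hq f => hpd hg i q (by omega) f
    rw [mul_comm f, wick_X_mul, sub_mul, mul_assoc, ih g hg]
    have h1 : wick (pderiv i f) * wick g + wick f * wick (pderiv i g) =
        wick (pderiv i (∑ q ∈ Finset.range Q, ((q.factorial : ℝ)⁻¹) • contr q f g)) := by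
      rw [← pderiv_wick, ← pderiv_wick, ← pderiv_wick, ← ih g hg, Derivation.leibniz, smul_eq_mul,
        smul_eq_mul]
      ring
    rw [h2] at h1
    have h3 : ∑ q ∈ Finset.range Q, ((q.factorial : ℝ)⁻¹) • contr q (X i * f) g =
        X i * ∑ q ∈ Finset.range Q, ((q.factorial : ℝ)⁻¹) • contr q f g +
          ∑ q ∈ Finset.range Q, ((q.factorial : ℝ)⁻¹) • contr q f (pderiv i g) := by
      simp only [contr_X_mul, smul_add, Finset.sum_add_distrib, Finset.mul_sum, mul_smul_comm]
      congr 1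
      cases Q with
      | zero => simp
      | succ Q =>
        -- The shift `q / q! = 1 / (q - 1)!` aligns the sums; the unmatched top term is zero by
        -- `hpd`.
        rw [Finset.sum_range_succ', Finset.sum_range_succ (fun q => _ • contr q f (pderiv i g)),
          hpd hg i Q le_rfl]
        simp only [Nat.cast_zero, zero_smul, smul_zero, Nat.add_sub_cancel, add_zero, smul_smul]
        refine Finset.sum_congr rfl fun q _ => ?_
        congr 1
        rw [Nat.factorial_succ]
        push_cast
        field_simp
    rw [h3, map_add, wick_X_mul]
    linear_combination -h1

end Wick
end GaussianPolynomial

namespace GaussianPolynomial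

open MvPolynomial

/-! ### Gaussian expectation of polynomials -/

theorem integrable_pow_gaussianReal (n : ℕ) :
    Integrable (fun x : ℝ => x ^ n) (gaussianReal 0 1) := by
  have h := (memLp_id_gaussianReal (μ := 0) (v := 1) (n : NNReal)).integrable_norm_pow'
  refine h.mono' (by fun_prop) (Filter.Eventually.of_forall fun x => ?_)
  simp

theorem hasDerivAt_gaussianPDFReal (x : ℝ) :
    HasDerivAt (gaussianPDFReal 0 1) (-(x * gaussianPDFReal 0 1 x)) x := by
  have h : HasDerivAt (fun y : ℝ => -(y - 0) ^ 2 / (2 * (1 : NNReal))) (-x) x := by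
    have := (((hasDerivAt_id x).sub_const 0).pow 2).neg.div_const (2 * ((1 : NNReal) : ℝ))
    refine this.congr_deriv ?_
    simp
    ring
  have h2 := (h.exp).const_mul (√(2 * Real.pi * (1 : NNReal)))⁻¹
  refine h2.congr_deriv ?_
  rw [gaussianPDFReal]
  ring

theorem integrable_pow_mul_gaussianPDFReal (n : ℕ) :
    Integrable fun x : ℝ => x ^ n * gaussianPDFReal 0 1 x := by
  have h := integrable_pow_gaussianReal n
  rw [gaussianReal_of_var_ne_zero _ one_ne_zero,
    integrable_withDensity_iff_integrable_smul' (measurable_gaussianPDF _ _)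
      (Filter.Eventually.of_forall fun _ => gaussianPDF_lt_top)] at h
  simpa [toReal_gaussianPDF, mul_comm] using h

/-- Integration by parts, the density `φ` satisfying `φ' = -xφ`. For `n = 0` the factor `n` hides
the truncated exponent. -/
theorem integral_pow_succ_gaussianReal (n : ℕ) :
    ∫ x : ℝ, x ^ (n + 1) ∂gaussianReal 0 1 = n * ∫ x : ℝ, x ^ (n - 1) ∂gaussianReal 0 1 := by
  rw [integral_gaussianReal_eq_integral_smul one_ne_zero,
    integral_gaussianReal_eq_integral_smul one_ne_zero, ← integral_const_mul]
  have h := integral_mul_deriv_eq_deriv_mul_of_integrable (u := fun x : ℝ => x ^ n)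
    (u' := fun x => n * x ^ (n - 1)) (v := gaussianPDFReal 0 1)
    (v' := fun x => -(x * gaussianPDFReal 0 1 x))
    (fun x _ => hasDerivAt_pow n x) (fun x _ => hasDerivAt_gaussianPDFReal x)
    (by
      refine (integrable_pow_mul_gaussianPDFReal (n + 1)).neg.congr
        (Filter.Eventually.of_forall fun x => ?_)
      simp [pow_succ, mul_assoc])
    (by
      refine ((integrable_pow_mul_gaussianPDFReal (n - 1)).const_mul (n : ℝ)).congr
        (Filter.Eventually.of_forall fun x => ?_)
      simp [mul_assoc])
    (integrable_pow_mul_gaussianPDFReal n)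
  rw [← neg_inj, ← integral_neg, ← integral_neg]
  rw [← integral_neg] at h
  refine Eq.trans (integral_congr_ae (Filter.Eventually.of_forall fun x => ?_))
    (h.trans (integral_congr_ae (Filter.Eventually.of_forall fun x => ?_)))
  · simp only [smul_eq_mul]; ring
  · simp only [smul_eq_mul]; ring

section Expectation

variable {σ : Type*} [Fintype σ]

/-- The standard Gaussian measure on `σ → ℝ`. -/
def stdG (σ : Type*) [Fintype σ] : Measure (σ → ℝ) := Measure.pi fun _ => gaussianReal 0 1

theorem integrable_aeval_stdG (p : MvPolynomial σ ℝ) :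
    Integrable (fun x : σ → ℝ => aeval x p) (stdG σ) := by
  induction p using MvPolynomial.induction_on' with
  | add p q hp hq => simp only [map_add]; exact hp.add hq
  | monomial s r =>
    have h := Integrable.fintype_prod (f := fun (j : σ) (x : ℝ) => x ^ s j)
      (μ := fun _ => gaussianReal 0 1) fun j => integrable_pow_gaussianReal (s j)
    refine (h.const_mul r).congr (Filter.Eventually.of_forall fun x => ?_)
    simp [aeval_monomial, Finsupp.prod_fintype]

/-- The expectation of a polynomial in independent standard normal variables. -/
def expect : MvPolynomial σ ℝ →ₗ[ℝ] ℝ where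
  toFun p := ∫ x : σ → ℝ, aeval x p ∂stdG σ
  map_add' p q := by
    simp only [map_add]
    exact integral_add (integrable_aeval_stdG p) (integrable_aeval_stdG q)
  map_smul' r p := by
    simp only [map_smul, RingHom.id_apply]
    exact integral_const_mul _ _

theorem expect_monomial (s : σ →₀ ℕ) (r : ℝ) :
    expect (monomial s r) = r * ∏ j, ∫ x : ℝ, x ^ s j ∂gaussianReal 0 1 := by
  change ∫ x : σ → ℝ, aeval x (monomial s r) ∂stdG σ = _
  rw [stdG, ← integral_fintype_prod_eq_prod (fun (j : σ) (x : ℝ) => x ^ s j), ← integral_const_mul]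
  simp [aeval_monomial, Finsupp.prod_fintype]

theorem expect_C (r : ℝ) : expect (C r : MvPolynomial σ ℝ) = r := by
  rw [← monomial_zero', expect_monomial]
  simp

theorem expect_X_mul (i : σ) (p : MvPolynomial σ ℝ) : expect (X i * p) = expect (pderiv i p) := by
  classical
  induction p using MvPolynomial.induction_on' with
  | add p q hp hq => rw [mul_add, map_add, map_add, map_add, hp, hq]
  | monomial s r =>
    have h : X i * monomial s r = monomial (Finsupp.single i 1 + s) r := by
      rw [X, monomial_mul, one_mul]
    rw [h, pderiv_monomial, expect_monomial, expect_monomial,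
      ← Finset.mul_prod_erase _ _ (Finset.mem_univ i),
      ← Finset.mul_prod_erase _ _ (Finset.mem_univ i), Finsupp.add_apply, Finsupp.single_eq_same,
      Finsupp.coe_tsub, Pi.sub_apply, Finsupp.single_eq_same, add_comm 1,
      integral_pow_succ_gaussianReal]
    have h1 : ∏ j ∈ Finset.univ.erase i,
        ∫ x : ℝ, x ^ (Finsupp.single i 1 + s : σ →₀ ℕ) j ∂gaussianReal 0 1 =
        ∏ j ∈ Finset.univ.erase i, ∫ x : ℝ, x ^ (s - Finsupp.single i 1 : σ →₀ ℕ) j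
          ∂gaussianReal 0 1 := Finset.prod_congr rfl fun j hj => by
      rw [Finsupp.add_apply, Finsupp.coe_tsub, Pi.sub_apply,
        Finsupp.single_eq_of_ne (Finset.ne_of_mem_erase hj), zero_add, Nat.sub_zero]
    rw [h1, Finsupp.coe_tsub]
    ring

/-- Integration by parts for Wick products. -/
theorem expect_wick_X_mul_mul (i : σ) (f G : MvPolynomial σ ℝ) :
    expect (wick (X i * f) * G) = expect (wick f * pderiv i G) := by
  rw [wick_X_mul, ← pderiv_wick, sub_mul, map_sub, mul_assoc, expect_X_mul, Derivation.leibniz,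
    smul_eq_mul, smul_eq_mul, map_add, mul_comm G]
  ring

end Expectation
end GaussianPolynomial

namespace GaussianPolynomial

/-! ### Multilinear bounds for tensors -/

theorem sum_comp_le_of_injective {α α' : Type*} [Fintype α] [Fintype α'] {φ : α → α'}
    (hφ : Function.Injective φ) {F : α' → ℝ} (hF : ∀ y, 0 ≤ F y) : ∑ x, F (φ x) ≤ ∑ y, F y := by
  classical
  rw [← Finset.sum_image (s := Finset.univ) (g := φ) (f := F) fun x _ y _ h => hφ h]
  exact Finset.sum_le_univ_sum_of_nonneg hF

theorem sum_sumArrow {R L σ M : Type*} [AddCommMonoid M] [Fintype R] [DecidableEq R] [Fintype L] [DecidableEq L]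
    [Fintype σ] (F : (R ⊕ L → σ) → M) :
    ∑ N, F N = ∑ i : R → σ, ∑ n : L → σ, F (Sum.elim i n) := by
  rw [← Fintype.sum_prod_type' (fun i n => F (Sum.elim i n))]
  exact (Fintype.sum_equiv (Equiv.sumArrowEquivProdArrow R L σ).symm _ _ fun _ => rfl).symm

section

variable {σ : Type*} [Fintype σ]

/-- `TBound θ A T` says that, for every partition of the legs of `T` into `s` blocks, the
multilinear form of `T` has norm at most `A θ ^ (s - 1)`. -/
def TBound {L : Type} [Fintype L] [DecidableEq L] (θ A : ℝ) (T : (L → σ) → ℝ) : Prop :=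
  ∀ (β : Type) [Fintype β] [DecidableEq β] (c : L → β), Function.Surjective c →
    ∀ b : ∀ x, ({l // c l = x} → σ) → ℝ,
      θ * |∑ n, T n * ∏ x, b x fun l => n l| ≤
        A * θ ^ Fintype.card β * ∏ x, √(∑ m, b x m ^ 2)

variable {R L K : Type} [Fintype R] [DecidableEq R] [Fintype L] [DecidableEq L] [Fintype K]
  [DecidableEq K]

/-- The contraction of two tensors over the legs in `R`. -/
def contract (T : (R ⊕ L → σ) → ℝ) (S : (R ⊕ K → σ) → ℝ) (n : L ⊕ K → σ) : ℝ :=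
  ∑ i : R → σ, T (Sum.elim i fun l => n (.inl l)) * S (Sum.elim i fun k => n (.inr k))

section

variable {β : Type} [Fintype β] [DecidableEq β] (c : L ⊕ K → β)

/-- Joins indices on the legs in `L` and in `K` that lie in a block that meets `K`. -/
def joinBlock (p : {l : L // ∃ k, c (.inr k) = c (.inl l)} → σ)
    (x : {x // ∃ k, c (.inr k) = x}) (q : {k : K // c (.inr k) = x.1} → σ) :
    {j // c j = x.1} → σ
  | ⟨.inl l, h⟩ => p ⟨l, by rw [h]; exact x.2⟩
  | ⟨.inr k, h⟩ => q ⟨k, h⟩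

/-- The contraction of `S` with the arrays whose block meets `K`. -/
def partialSum (S : (R ⊕ K → σ) → ℝ) (b : ∀ x, ({j // c j = x} → σ) → ℝ) (i : R → σ)
    (p : {l : L // ∃ k, c (.inr k) = c (.inl l)} → σ) : ℝ :=
  ∑ nK : K → σ, S (Sum.elim i nK) *
    ∏ x : {x // ∃ k, c (.inr k) = x}, b x.1 (joinBlock c p x fun k => nK k.1)

/-- After expanding the product, distinct choices of `p` and of the `q`s give distinct index
families on the blocks meeting `K`. The left side is thus part of a sum of nonnegative terms. -/
theorem sum_prod_joinBlock_le (b : ∀ x, ({j // c j = x} → σ) → ℝ) :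
    ∑ p, ∏ x, ∑ q, b x.1 (joinBlock c p x q) ^ 2 ≤
      ∏ x : {x // ∃ k, c (.inr k) = x}, ∑ m, b x.1 m ^ 2 := by
  rw [Finset.prod_univ_sum]
  simp_rw [Finset.prod_univ_sum, Fintype.piFinset_univ]
  rw [← Fintype.sum_prod_type' (fun (p : {l : L // ∃ k, c (.inr k) = c (.inl l)} → σ)
    (q : ∀ x : {x // ∃ k, c (.inr k) = x}, {k : K // c (.inr k) = x.1} → σ) =>
      ∏ x, b x.1 (joinBlock c p x (q x)) ^ 2)]
  refine sum_comp_le_of_injective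
    (φ := fun z : ({l : L // ∃ k, c (.inr k) = c (.inl l)} → σ) ×
      (∀ x : {x // ∃ k, c (.inr k) = x}, {k : K // c (.inr k) = x.1} → σ) =>
        fun x => joinBlock c z.1 x (z.2 x))
    (F := fun m => ∏ x, b x.1 (m x) ^ 2) ?_ fun m => Finset.prod_nonneg fun x _ => sq_nonneg _
  rintro ⟨p, q⟩ ⟨p', q'⟩ h
  refine Prod.ext (funext fun l => ?_) (funext fun x => funext fun k => ?_)
  · exact congrFun (congrFun h ⟨c (.inl l.1), l.2⟩) ⟨.inl l.1, rfl⟩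
  · exact congrFun (congrFun h x) ⟨.inr k.1, k.2⟩

/-- Duality: for fixed `p`, test `S` with its own partial sum on the legs `R`. This gives `N ≤ D √N
√P`, hence `N ≤ D² P`; then sum over `p`. -/
theorem sum_partialSum_sq_le [Nonempty R] {θ A : ℝ} (hθ : 0 < θ) (hA : 0 ≤ A)
    {S : (R ⊕ K → σ) → ℝ} (hS : TBound θ A S) (b : ∀ x, ({j // c j = x} → σ) → ℝ) :
    ∑ p, ∑ i, partialSum c S b i p ^ 2 ≤
      (A * θ ^ Fintype.card {x // ∃ k, c (.inr k) = x}) ^ 2 *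
        ∏ x : {x // ∃ k, c (.inr k) = x}, ∑ m, b x.1 m ^ 2 := by
  refine le_trans ?_ (mul_le_mul_of_nonneg_left (sum_prod_joinBlock_le c b) (sq_nonneg _))
  rw [Finset.mul_sum]
  refine Finset.sum_le_sum fun p _ => ?_
  set N := ∑ i, partialSum c S b i p ^ 2 with hN
  have hN0 : 0 ≤ N := Finset.sum_nonneg fun _ _ => sq_nonneg _
  -- All of `R` is the single block `none`. This extra block supplies the one power of `θ` that
  -- cancels the factor in front of `TBound`.
  let cS : R ⊕ K → Option {x // ∃ k, c (.inr k) = x} :=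
    Sum.elim (fun _ => none) fun k => some ⟨c (.inr k), k, rfl⟩
  have hcS : Function.Surjective cS := by
    rintro (_ | ⟨x, k, rfl⟩)
    · exact ⟨.inl (Classical.arbitrary R), rfl⟩
    · exact ⟨.inr k, rfl⟩
  have hcK : ∀ (x : {x // ∃ k, c (.inr k) = x}) (k : K), c (.inr k) = x.1 →
      cS (.inr k) = some x := fun x k hk => congrArg some (Subtype.ext hk)
  let bS : ∀ y, ({j // cS j = y} → σ) → ℝ
    | none => fun m => partialSum c S b (fun r => m ⟨.inl r, rfl⟩) p
    | some x => fun m => b x.1 (joinBlock c p x fun k => m ⟨.inr k.1, hcK x k.1 k.2⟩)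
  have h := hS _ cS hcS bS
  have h1 : ∑ n, S n * ∏ y, bS y (fun l => n l) = N := by
    rw [sum_sumArrow, hN]
    refine Finset.sum_congr rfl fun i _ => ?_
    conv_rhs => rw [sq]; arg 1; rw [partialSum]
    rw [Finset.sum_mul]
    refine Finset.sum_congr rfl fun nK _ => ?_
    rw [Fintype.prod_option]
    simp only [bS, Sum.elim_inl, Sum.elim_inr]
    ring
  have h2 : ∑ m, bS none m ^ 2 ≤ N := by
    refine sum_comp_le_of_injective
      (φ := fun (m : {j // cS j = none} → σ) (r : R) => m ⟨.inl r, rfl⟩)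
      (F := fun i => partialSum c S b i p ^ 2) (fun m m' hm => ?_) fun _ => sq_nonneg _
    funext ⟨j, hj⟩
    rcases j with r | k
    · exact congrFun hm r
    · simp [cS] at hj
  have h3 : ∀ x, ∑ m, bS (some x) m ^ 2 ≤ ∑ q, b x.1 (joinBlock c p x q) ^ 2 := fun x => by
    refine sum_comp_le_of_injective
      (φ := fun (m : {j // cS j = some x} → σ) (k : {k : K // c (.inr k) = x.1}) =>
        m ⟨.inr k.1, hcK x k.1 k.2⟩)
      (F := fun q => b x.1 (joinBlock c p x q) ^ 2) (fun m m' hm => ?_) fun _ => sq_nonneg _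
    funext ⟨j, hj⟩
    rcases j with r | k
    · simp [cS] at hj
    · exact congrFun hm ⟨k, congrArg Subtype.val (Option.some_injective _ hj)⟩
  rw [h1, abs_of_nonneg hN0, Fintype.card_option, Fintype.prod_option] at h
  set P := ∏ x : {x // ∃ k, c (.inr k) = x}, ∑ q, b x.1 (joinBlock c p x q) ^ 2 with hP
  have hP0 : 0 ≤ P := Finset.prod_nonneg fun _ _ => Finset.sum_nonneg fun _ _ => sq_nonneg _
  have h4 : ∏ x, √(∑ m, bS (some x) m ^ 2) ≤ √P := by
    rw [hP, Real.sqrt_prod _ fun _ _ => Finset.sum_nonneg fun _ _ => sq_nonneg _]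
    exact Finset.prod_le_prod (fun _ _ => Real.sqrt_nonneg _) fun x _ => Real.sqrt_le_sqrt (h3 x)
  have h5 : θ * N ≤ θ * (A * θ ^ Fintype.card {x // ∃ k, c (.inr k) = x} * (√N * √P)) := by
    refine h.trans ?_
    rw [pow_succ]
    calc _ ≤ A * (θ ^ Fintype.card {x // ∃ k, c (.inr k) = x} * θ) * (√N * √P) := by
          gcongr
      _ = _ := by ring
  have h6 := le_of_mul_le_mul_left h5 hθ
  set D := A * θ ^ Fintype.card {x // ∃ k, c (.inr k) = x}
  have hD : 0 ≤ D := by positivity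
  have h7 : √N * √N ≤ √N * (D * √P) := by rw [Real.mul_self_sqrt hN0]; linarith
  rcases hN0.eq_or_lt with h0 | h0
  · rw [← h0]; positivity
  · have h8 := le_of_mul_le_mul_left h7 (Real.sqrt_pos.mpr h0)
    rw [← Real.sq_sqrt hN0, ← Real.sq_sqrt hP0, ← mul_pow]
    exact pow_le_pow_left₀ (Real.sqrt_nonneg _) h8 2

/-- With `r` blocks meeting `K` and `t` blocks inside `L`, the tensor `S` is tested with `r + 1`
blocks and `T` with `t + 1`. The contracted legs make the block `none` nonempty in both tests. -/
theorem TBound.contract [Nonempty R] {θ A B : ℝ} (hθ : 0 < θ) (hA : 0 ≤ A) (hB : 0 ≤ B)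
    {T : (R ⊕ L → σ) → ℝ} {S : (R ⊕ K → σ) → ℝ} (hT : TBound θ A T) (hS : TBound θ B S) :
    TBound θ (θ * A * B) (contract T S) := by
  intro β _ _ c hc b
  -- The legs of `R`, together with the legs of `L` whose block meets `K`, become one block carrying
  -- the partial sum of `S`. The other blocks lie inside `L` and keep their arrays.
  let cT : R ⊕ L → Option {x // ¬ ∃ k, c (.inr k) = x} :=
    Sum.elim (fun _ => none) fun l =>
      if h : ∃ k, c (.inr k) = c (.inl l) then none else some ⟨c (.inl l), h⟩
  have hcT : Function.Surjective cT := by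
    rintro (_ | ⟨x, hx⟩)
    · exact ⟨.inl (Classical.arbitrary R), rfl⟩
    · obtain ⟨l | k, rfl⟩ := hc x
      · exact ⟨.inr l, dif_neg hx⟩
      · exact absurd ⟨k, rfl⟩ hx
  have hcN : ∀ l : {l : L // ∃ k, c (.inr k) = c (.inl l)}, cT (.inr l.1) = none := fun l =>
    dif_pos l.2
  have hcL : ∀ (y : {x // ¬ ∃ k, c (.inr k) = x}) (l : L), c (.inl l) = y.1 →
      cT (.inr l) = some y := fun y l hl => by
    have : ¬ ∃ k, c (.inr k) = c (.inl l) := by rw [hl]; exact y.2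
    exact (dif_neg this).trans (congrArg some (Subtype.ext hl))
  let ext : ∀ y : {x // ¬ ∃ k, c (.inr k) = x}, ({l : L // c (.inl l) = y.1} → σ) →
      {j // c j = y.1} → σ := fun y m j => match j with
    | ⟨.inl l, h⟩ => m ⟨l, h⟩
    | ⟨.inr k, h⟩ => absurd ⟨k, h⟩ y.2
  let bT : ∀ y, ({j // cT j = y} → σ) → ℝ
    | none => fun m => partialSum c S b (fun r => m ⟨.inl r, rfl⟩) fun l => m ⟨.inr l.1, hcN l⟩
    | some y => fun m => b y.1 (ext y fun l => m ⟨.inr l.1, hcL y l.1 l.2⟩)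
  have h := hT _ cT hcT bT
  have h1 : ∑ n, T n * ∏ y, bT y (fun l => n l) =
      ∑ n, GaussianPolynomial.contract T S n * ∏ x, b x (fun l => n l) := by
    simp only [GaussianPolynomial.contract]
    simp_rw [Finset.sum_mul]
    rw [Finset.sum_comm, sum_sumArrow]
    refine Finset.sum_congr rfl fun i _ => ?_
    rw [sum_sumArrow]
    refine Finset.sum_congr rfl fun nL _ => ?_
    rw [Fintype.prod_option]
    simp only [bT, Sum.elim_inl, Sum.elim_inr, partialSum]
    rw [mul_comm (Finset.sum _ _), ← mul_assoc, Finset.mul_sum]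
    refine Finset.sum_congr rfl fun nK _ => ?_
    rw [← Fintype.prod_subtype_mul_prod_subtype (fun x => ∃ k, c (.inr k) = x)
      (fun x => b x fun l => Sum.elim nL nK l.1)]
    have e1 : ∀ x : {x // ∃ k, c (.inr k) = x},
        joinBlock c (fun l => nL l.1) x (fun k => nK k.1) = fun l => Sum.elim nL nK l.1 :=
      fun x => funext fun ⟨j, hj⟩ => by rcases j with l | k <;> rfl
    have e2 : ∀ y : {x // ¬ ∃ k, c (.inr k) = x},
        ext y (fun l => nL l.1) = fun l => Sum.elim nL nK l.1 :=
      fun y => funext fun ⟨j, hj⟩ => by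
        rcases j with l | k
        · rfl
        · exact absurd ⟨k, hj⟩ y.2
    simp only [e1, e2]
    ring
  have h2 : ∑ m, bT none m ^ 2 ≤ ∑ p, ∑ i, partialSum c S b i p ^ 2 := by
    rw [← Fintype.sum_prod_type' (fun p i => partialSum c S b i p ^ 2)]
    refine sum_comp_le_of_injective
      (φ := fun (m : {j // cT j = none} → σ) =>
        ((fun l => m ⟨.inr l.1, hcN l⟩, fun r => m ⟨.inl r, rfl⟩) :
          ({l : L // ∃ k, c (.inr k) = c (.inl l)} → σ) × (R → σ)))
      (F := fun z => partialSum c S b z.2 z.1 ^ 2) (fun m m' hm => ?_) fun _ => sq_nonneg _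
    funext ⟨j, hj⟩
    rcases j with r | l
    · exact congrFun (congrArg Prod.snd hm) r
    · have : ∃ k, c (.inr k) = c (.inl l) := by
        by_contra hl
        simp [cT, dif_neg hl] at hj
      exact congrFun (congrArg Prod.fst hm) ⟨l, this⟩
  have h3 : ∀ y, ∑ m, bT (some y) m ^ 2 ≤ ∑ m, b y.1 m ^ 2 := fun y => by
    refine sum_comp_le_of_injective
      (φ := fun (m : {j // cT j = some y} → σ) => ext y fun l => m ⟨.inr l.1, hcL y l.1 l.2⟩)
      (F := fun q => b y.1 q ^ 2) (fun m m' hm => ?_) fun _ => sq_nonneg _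
    funext ⟨j, hj⟩
    rcases j with r | l
    · simp [cT] at hj
    · have : c (.inl l) = y.1 := by
        by_cases hl : ∃ k, c (.inr k) = c (.inl l)
        · simp [cT, dif_pos hl] at hj
        · have h' : cT (.inr l) = some ⟨c (.inl l), hl⟩ := dif_neg hl
          exact congrArg Subtype.val (Option.some_injective _ (h'.symm.trans hj))
      exact congrFun hm ⟨.inl l, this⟩
  have h4 := h2.trans (sum_partialSum_sq_le c hθ hB hS b)
  rw [h1, Fintype.card_option, Fintype.prod_option] at h
  refine h.trans ?_
  have hcard : Fintype.card β = Fintype.card {x // ∃ k, c (.inr k) = x} +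
      Fintype.card {x // ¬ ∃ k, c (.inr k) = x} := by
    rw [← Fintype.card_sum]
    exact Fintype.card_congr (Equiv.sumCompl _).symm
  have h5 : √(∑ m, bT none m ^ 2) ≤ B * θ ^ Fintype.card {x // ∃ k, c (.inr k) = x} *
      ∏ x : {x // ∃ k, c (.inr k) = x}, √(∑ m, b x.1 m ^ 2) := by
    rw [← Real.sqrt_prod _ fun _ _ => Finset.sum_nonneg fun _ _ => sq_nonneg _]
    refine Real.sqrt_le_iff.mpr ⟨by positivity, h4.trans_eq ?_⟩
    rw [mul_pow _ (√_), Real.sq_sqrt]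
    exact Finset.prod_nonneg fun _ _ => Finset.sum_nonneg fun _ _ => sq_nonneg _
  have h6 : ∏ y, √(∑ m, bT (some y) m ^ 2) ≤
      ∏ y : {x // ¬ ∃ k, c (.inr k) = x}, √(∑ m, b y.1 m ^ 2) :=
    Finset.prod_le_prod (fun _ _ => Real.sqrt_nonneg _) fun x _ => Real.sqrt_le_sqrt (h3 x)
  rw [hcard, ← Fintype.prod_subtype_mul_prod_subtype (fun x => ∃ k, c (.inr k) = x), pow_add,
    pow_succ]
  refine (mul_le_mul_of_nonneg_left (mul_le_mul h5 h6 (Finset.prod_nonneg fun _ _ =>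
    Real.sqrt_nonneg _) ((Real.sqrt_nonneg _).trans h5)) (by positivity)).trans_eq ?_
  generalize ∏ x : {x // ∃ k, c (.inr k) = x}, √(∑ m, b x.1 m ^ 2) = u
  generalize ∏ x : {x // ¬ ∃ k, c (.inr k) = x}, √(∑ m, b x.1 m ^ 2) = v
  ring

end

end
end GaussianPolynomial

/-! ### Homogeneous polynomials of tensors and their contractions -/

namespace GaussianPolynomial

open MvPolynomial

theorem pderiv_prod_X {σ L : Type*} [DecidableEq σ] [DecidableEq L] (j : σ) (n : L → σ) (s : Finset L) :
    pderiv j (∏ l ∈ s, X (n l) : MvPolynomial σ ℝ) =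
      ∑ l ∈ s, if n l = j then ∏ l' ∈ s.erase l, X (n l') else 0 := by
  induction s using Finset.induction_on with
  | empty => simp
  | insert a s ha ih =>
    rw [Finset.prod_insert ha, Derivation.leibniz, ih, Finset.sum_insert ha,
      Finset.erase_insert ha, pderiv_X, Pi.single_apply, add_comm, smul_eq_mul, smul_eq_mul,
      Finset.mul_sum]
    congr 1
    · by_cases h : n a = j
      · simp [h]
      · simp [h]
    · refine Finset.sum_congr rfl fun l hl => ?_
      have hla : a ≠ l := fun h => ha (h ▸ hl)
      rw [Finset.erase_insert_of_ne hla, Finset.prod_insert (fun h => ha (Finset.mem_of_mem_erase h)),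
        mul_ite, mul_zero]

section

variable {σ : Type*} [Fintype σ] {L K R : Type} [Fintype L] [DecidableEq L] [Fintype K]
  [DecidableEq K] [Fintype R] [DecidableEq R] {θ A B : ℝ}

theorem TBound.zero : TBound θ 0 (0 : (L → σ) → ℝ) := fun β _ _ c hc b => by simp

theorem TBound.add (hθ : 0 ≤ θ) {T S : (L → σ) → ℝ} (hT : TBound θ A T) (hS : TBound θ B S) :
    TBound θ (A + B) (T + S) := fun β _ _ c hc b => by
  have h1 := hT β c hc b
  have h2 := hS β c hc b
  simp only [Pi.add_apply, add_mul, Finset.sum_add_distrib]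
  have h3 := mul_le_mul_of_nonneg_left (abs_add_le (∑ n, T n * ∏ x, b x fun l => n l)
    (∑ n, S n * ∏ x, b x fun l => n l)) hθ
  linarith

theorem TBound.congr (e : L ≃ K) (hθ : 0 ≤ θ) (hA : 0 ≤ A) {T : (L → σ) → ℝ} (hT : TBound θ A T) :
    TBound θ A fun n : K → σ => T fun l => n (e l) := fun β _ _ c hc b => by
  let b' : ∀ x, ({l // c (e l) = x} → σ) → ℝ := fun x m =>
    b x fun j => m ⟨e.symm j.1, by rw [e.apply_symm_apply]; exact j.2⟩
  have h := hT β (fun l => c (e l)) (hc.comp e.surjective) b'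
  have h1 : ∑ n, T n * ∏ x, b' x (fun l => n l) =
      ∑ n : K → σ, T (fun l => n (e l)) * ∏ x, b x (fun l => n l) := by
    refine Fintype.sum_equiv (e.arrowCongr (Equiv.refl σ)) _ _ fun n => ?_
    simp [b', Equiv.arrowCongr]
  rw [h1] at h
  refine h.trans (mul_le_mul_of_nonneg_left (Finset.prod_le_prod
    (fun _ _ => Real.sqrt_nonneg _) fun x _ => Real.sqrt_le_sqrt ?_) (by positivity))
  refine sum_comp_le_of_injective
    (φ := fun (m : {l // c (e l) = x} → σ) (j : {j // c j = x}) =>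
      m ⟨e.symm j.1, by rw [e.apply_symm_apply]; exact j.2⟩)
    (F := fun m => b x m ^ 2) (fun m m' hm => ?_) fun _ => sq_nonneg _
  funext ⟨l, hl⟩
  simpa using congrFun hm ⟨e l, hl⟩

/-- The homogeneous polynomial with coefficients `T`. -/
def tensorPoly (T : (L → σ) → ℝ) : MvPolynomial σ ℝ := ∑ n, T n • ∏ l, X (n l)

theorem tensorPoly_congr (e : L ≃ K) (T : (L → σ) → ℝ) :
    tensorPoly (fun n : K → σ => T fun l => n (e l)) = tensorPoly T := by
  refine (Fintype.sum_equiv (e.arrowCongr (Equiv.refl σ)) _ _ fun n => ?_).symm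
  simp only [Equiv.arrowCongr, Equiv.coe_fn_mk, Equiv.coe_refl, Function.id_comp,
    Function.comp_apply, Equiv.symm_apply_apply]
  congr 1
  exact Fintype.prod_equiv e _ _ fun l => by simp

theorem contr_tensorPoly_eq_zero (q : ℕ) (hq : Fintype.card L < q) (f : MvPolynomial σ ℝ)
    (S : (L → σ) → ℝ) : contr q f (tensorPoly S) = 0 := by
  rw [tensorPoly, contr_sum_right]
  refine Finset.sum_eq_zero fun n _ => ?_
  rw [contr_comm, contr_smul_left, contr_comm, contr_prod_X_eq_zero _ _ _ hq, smul_zero]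

/-- The tensor obtained from `T` by fixing the index on the leg `l`. -/
def fixLeg {σ L : Type*} [DecidableEq L] (T : (L → σ) → ℝ) (l : L) (j : σ) (n : {l' // l' ≠ l} → σ) : ℝ :=
  T ((Equiv.funSplitAt l σ).symm (j, n))

theorem pderiv_tensorPoly (j : σ) (T : (L → σ) → ℝ) :
    pderiv j (tensorPoly T) = ∑ l, tensorPoly (fixLeg T l j) := by
  classical
  rw [tensorPoly, map_sum]
  simp_rw [Derivation.map_smul, pderiv_prod_X, Finset.smul_sum]
  rw [Finset.sum_comm]
  refine Finset.sum_congr rfl fun l _ => ?_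
  rw [tensorPoly, ← (Equiv.funSplitAt l σ).symm.sum_comp, Fintype.sum_prod_type,
    Finset.sum_eq_single j]
  · refine Finset.sum_congr rfl fun n _ => ?_
    have h1 : (Equiv.funSplitAt l σ).symm (j, n) l = j := by simp
    rw [if_pos h1, fixLeg]
    congr 1
    rw [Finset.prod_subtype (Finset.univ.erase l) (p := fun l' => l' ≠ l) (by simp)
      (fun l' => (X ((Equiv.funSplitAt l σ).symm (j, n) l') : MvPolynomial σ ℝ))]
    refine Finset.prod_congr rfl fun l' _ => ?_
    simp [l'.2]
  · intro i _ hij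
    refine Finset.sum_eq_zero fun n _ => ?_
    rw [if_neg (by simpa using hij), smul_zero]
  · simp

/-- `HasTensor θ o A f` says that `f` is the polynomial of a tensor with `o` legs that is bounded
by `A`. -/
def HasTensor (θ : ℝ) (o : ℕ) (A : ℝ) (f : MvPolynomial σ ℝ) : Prop :=
  ∃ T : (Fin o → σ) → ℝ, TBound θ A T ∧ f = tensorPoly T

theorem HasTensor.of_tensorPoly (hθ : 0 ≤ θ) (hA : 0 ≤ A) {o : ℕ} (ho : Fintype.card L = o)
    {T : (L → σ) → ℝ} (hT : TBound θ A T) : HasTensor θ o A (tensorPoly T) :=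
  ⟨_, hT.congr (Fintype.equivFinOfCardEq ho) hθ hA, (tensorPoly_congr _ _).symm⟩

theorem HasTensor.zero (o : ℕ) : HasTensor θ o 0 (0 : MvPolynomial σ ℝ) :=
  ⟨0, TBound.zero, by simp [tensorPoly]⟩

theorem HasTensor.add (hθ : 0 ≤ θ) {o : ℕ} {f g : MvPolynomial σ ℝ} (hf : HasTensor θ o A f)
    (hg : HasTensor θ o B g) : HasTensor θ o (A + B) (f + g) := by
  obtain ⟨T, hT, rfl⟩ := hf
  obtain ⟨S, hS, rfl⟩ := hg
  exact ⟨T + S, hT.add hθ hS, by simp [tensorPoly, add_smul, Finset.sum_add_distrib]⟩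

theorem HasTensor.sum (hθ : 0 ≤ θ) {o : ℕ} {α : Type*} (s : Finset α) {A : α → ℝ}
    {f : α → MvPolynomial σ ℝ} (hf : ∀ x ∈ s, HasTensor θ o (A x) (f x)) :
    HasTensor θ o (∑ x ∈ s, A x) (∑ x ∈ s, f x) := by
  classical
  induction s using Finset.induction_on with
  | empty => simpa using HasTensor.zero o
  | insert a s ha ih =>
    rw [Finset.sum_insert ha, Finset.sum_insert ha]
    exact (hf a (Finset.mem_insert_self _ _)).add hθ
      (ih fun x hx => hf x (Finset.mem_insert_of_mem hx))

/-- Moves the leg `l` to the fixed legs. -/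
def moveLeg (R : Type*) {L : Type*} [DecidableEq L] (l : L) : R ⊕ L ≃ (R ⊕ PUnit.{1}) ⊕ {l' // l' ≠ l} :=
  ((Equiv.refl R).sumCongr (((Equiv.optionSubtypeNe l).symm.trans
    (Equiv.optionEquivSumPUnit.{0} _)).trans (Equiv.sumComm _ _))).trans (Equiv.sumAssoc _ _ _).symm

theorem fixLeg_eq_moveLeg {σ L R : Type*} [DecidableEq L] (T : (R ⊕ L → σ) → ℝ) (l : L)
    (i : R → σ) (j : σ) : fixLeg (fun m => T (Sum.elim i m)) l j =
      fun n => T fun y => Sum.elim (Sum.elim i fun _ => j) n (moveLeg R l y) := by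
  funext n
  rw [fixLeg]
  congr 1
  funext y
  rcases y with r | l'
  · rfl
  · by_cases h : l' = l
    · subst h
      simp [moveLeg]
    · simp [moveLeg, h]

/-- `R` holds the legs already paired. Each further contraction chooses a leg on both sides and
moves the pair into `R`; the descending factorials count the choices. The contraction is carried out
only at the end, so `θ` appears once, whatever `q` is. -/
theorem sum_contr_tensorPoly [Nonempty R] (hθ : 0 < θ) (hA : 0 ≤ A) (hB : 0 ≤ B) (q : ℕ)
    {T : (R ⊕ L → σ) → ℝ} {S : (R ⊕ K → σ) → ℝ} (hT : TBound θ A T) (hS : TBound θ B S) :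
    HasTensor θ (Fintype.card L + Fintype.card K - 2 * q)
      ((Fintype.card L).descFactorial q * (Fintype.card K).descFactorial q * (θ * A * B))
      (∑ i : R → σ, contr q (tensorPoly fun n => T (Sum.elim i n))
        (tensorPoly fun n => S (Sum.elim i n))) := by
  induction q generalizing R L K with
  | zero =>
    have h : ∑ i : R → σ, contr 0 (tensorPoly fun n => T (Sum.elim i n))
        (tensorPoly fun n => S (Sum.elim i n)) = tensorPoly (contract T S) := by
      simp only [contr, tensorPoly, contract, Finset.sum_smul]
      rw [Finset.sum_comm]
      refine Finset.sum_congr rfl fun i _ => ?_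
      rw [Finset.sum_mul_sum, sum_sumArrow]
      refine Finset.sum_congr rfl fun n _ => Finset.sum_congr rfl fun m _ => ?_
      rw [Fintype.prod_sum_type, smul_mul_smul_comm]
      rfl
    rw [h]
    refine HasTensor.of_tensorPoly hθ.le (by positivity) (by simp) ?_
    simpa using hT.contract hθ hA hB hS
  | succ q ih =>
    have h : ∑ i : R → σ, contr (q + 1) (tensorPoly fun n => T (Sum.elim i n))
        (tensorPoly fun n => S (Sum.elim i n)) =
        ∑ l : L, ∑ k : K, ∑ i : R ⊕ PUnit.{1} → σ,
          contr q (tensorPoly fun n => T fun y => Sum.elim i n (moveLeg R l y))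
            (tensorPoly fun n => S fun y => Sum.elim i n (moveLeg R k y)) := by
      simp only [contr, pderiv_tensorPoly, contr_sum_left, contr_sum_right]
      simp_rw [sum_sumArrow (R := R) (L := PUnit.{1}), fixLeg_eq_moveLeg]
      have hu : ∀ F : (PUnit.{1} → σ) → MvPolynomial σ ℝ, ∑ u, F u = ∑ j, F fun _ => j :=
        fun F => Fintype.sum_equiv (Equiv.punitArrowEquiv σ) _ _ fun u => rfl
      simp_rw [hu]
      have swap : ∀ F : (R → σ) → σ → L → K → MvPolynomial σ ℝ,
          ∑ i, ∑ j, ∑ k, ∑ l, F i j l k = ∑ l, ∑ k, ∑ i, ∑ j, F i j l k := fun F => by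
        rw [Finset.sum_comm' (t' := Finset.univ) (s' := fun _ => Finset.univ) (by simp)]
        calc _ = ∑ j, ∑ i, ∑ l, ∑ k, F i j l k := Finset.sum_congr rfl fun j _ =>
              Finset.sum_congr rfl fun i _ => Finset.sum_comm
          _ = ∑ z : σ × (R → σ), ∑ l, ∑ k, F z.2 z.1 l k :=
              (Fintype.sum_prod_type fun z : σ × (R → σ) => ∑ l, ∑ k, F z.2 z.1 l k).symm
          _ = ∑ l, ∑ k, ∑ z : σ × (R → σ), F z.2 z.1 l k := by
              rw [Finset.sum_comm]
              exact Finset.sum_congr rfl fun l _ => Finset.sum_comm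
          _ = _ := Finset.sum_congr rfl fun l _ => Finset.sum_congr rfl fun k _ => by
              rw [Fintype.sum_prod_type, Finset.sum_comm]
      exact swap _
    rw [h]
    have h1 : ∀ (l : L) (k : K), HasTensor θ
        (Fintype.card L + Fintype.card K - 2 * (q + 1))
        ((Fintype.card L - 1).descFactorial q * (Fintype.card K - 1).descFactorial q * (θ * A * B))
        (∑ i : R ⊕ PUnit.{1} → σ,
          contr q (tensorPoly fun n => T fun y => Sum.elim i n (moveLeg R l y))
            (tensorPoly fun n => S fun y => Sum.elim i n (moveLeg R k y))) := fun l k => by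
      have h2 := ih (hT.congr (moveLeg R l) hθ.le hA) (hS.congr (moveLeg R k) hθ.le hB)
      have hL : Fintype.card {l' // l' ≠ l} = Fintype.card L - 1 := by simp
      have hK : Fintype.card {k' // k' ≠ k} = Fintype.card K - 1 := by simp
      have hL0 : 0 < Fintype.card L := Fintype.card_pos_iff.mpr ⟨l⟩
      have hK0 : 0 < Fintype.card K := Fintype.card_pos_iff.mpr ⟨k⟩
      rw [hL, hK, show Fintype.card L - 1 + (Fintype.card K - 1) - 2 * q =
        Fintype.card L + Fintype.card K - 2 * (q + 1) by omega] at h2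
      exact h2
    have h3 := HasTensor.sum hθ.le Finset.univ fun l _ =>
      HasTensor.sum hθ.le Finset.univ fun k _ => h1 l k
    have hd : ∀ n : ℕ, ((n.descFactorial (q + 1) : ℕ) : ℝ) = n * (n - 1).descFactorial q := by
      rintro (_ | n)
      · simp
      · rw [Nat.succ_descFactorial_succ]; push_cast; simp
    simp only [Finset.sum_const, Finset.card_univ, nsmul_eq_mul] at h3
    rw [hd, hd]
    convert h3 using 1
    ring

end
end GaussianPolynomial

/-! ### Exploration of the diagrams and the moment bound -/

namespace GaussianPolynomial

open MvPolynomial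

section

variable {σ : Type*} [Fintype σ] {θ A B : ℝ}

theorem tensorPoly_of_isEmpty {L : Type} [Fintype L] [DecidableEq L] [IsEmpty L]
    (T : (L → σ) → ℝ) : tensorPoly T = C (T isEmptyElim) := by
  rw [tensorPoly, Fintype.sum_unique, Finset.univ_eq_empty, Finset.prod_empty, ← C_1,
    smul_eq_C_mul, ← C_mul, mul_one]
  rfl

/-- The case of zero blocks, where the exponent `s - 1` would be `-1`. Because `TBound` carries a
factor `θ` on the left, it covers this case: a completed component costs `1/θ`. -/
theorem TBound.abs_le_of_isEmpty {L : Type} [Fintype L] [DecidableEq L] [IsEmpty L]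
    {T : (L → σ) → ℝ} (hT : TBound θ A T) : θ * |T isEmptyElim| ≤ A := by
  have h := hT Empty isEmptyElim (fun x => x.elim) fun x => x.elim
  rw [Fintype.sum_unique] at h
  rw [show (fun l : L => isEmptyElim l : L → σ) = default from Subsingleton.elim _ _]
  simpa using h

/-- A tensor whose legs are `PUnit ⊕ L` has a polynomial that splits off one variable. -/
theorem tensorPoly_punit_sum {L : Type} [Fintype L] [DecidableEq L]
    (T : (PUnit.{1} ⊕ L → σ) → ℝ) :
    tensorPoly T = ∑ j : σ, X j * tensorPoly fun n => T (Sum.elim (fun _ => j) n) := by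
  rw [tensorPoly, sum_sumArrow]
  refine Fintype.sum_equiv (Equiv.punitArrowEquiv σ) _ _ fun u => ?_
  rw [tensorPoly, Finset.mul_sum]
  refine Finset.sum_congr rfl fun n _ => ?_
  rw [Fintype.prod_sum_type, mul_smul_comm]
  simp [Equiv.punitArrowEquiv]

theorem expect_wick_eq_zero (j : σ) (f : MvPolynomial σ ℝ) : expect (wick (X j * f)) = 0 := by
  simpa using expect_wick_X_mul_mul j f 1

/-- One step of the exploration of the diagrams: the first leg of `f` is paired with a leg of one
of the factors `wick a`, and these two factors are multiplied. -/
theorem expect_wick_mul_pow_succ (hθ : 0 < θ) (hA : 0 ≤ A) (hB : 0 ≤ B) {o k : ℕ}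
    {f a : MvPolynomial σ ℝ} (hf : HasTensor θ (o + 1) B f) (ha : HasTensor θ k A a) (u : ℕ) :
    ∃ h : ℕ → Fin k → MvPolynomial σ ℝ,
      (∀ q l, HasTensor θ (o + (k - 1) - 2 * q)
        (o.descFactorial q * (k - 1).descFactorial q * (θ * B * A)) (h q l)) ∧
      expect (wick f * wick a ^ (u + 1)) = (u + 1) * ∑ q ∈ Finset.range k, ∑ l : Fin k,
        ((q.factorial : ℝ)⁻¹) * expect (wick (h q l) * wick a ^ u) := by
  obtain ⟨T, hT, rfl⟩ := hf
  obtain ⟨S, hS, rfl⟩ := ha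
  let e : Fin (o + 1) ≃ PUnit.{1} ⊕ Fin o :=
    Fintype.equivOfCardEq (by simp [add_comm])
  let e' : ∀ l : Fin k, Fin k ≃ PUnit.{1} ⊕ {l' // l' ≠ l} := fun l =>
    ((Equiv.optionSubtypeNe l).symm.trans (Equiv.optionEquivSumPUnit.{0} _)).trans
      (Equiv.sumComm _ _)
  let T' : (PUnit.{1} ⊕ Fin o → σ) → ℝ := fun n => T fun l => n (e l)
  let S' : ∀ l : Fin k, (PUnit.{1} ⊕ {l' // l' ≠ l} → σ) → ℝ := fun l n => S fun y => n (e' l y)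
  have hT' : TBound θ B T' := hT.congr e hθ.le hB
  have hS' : ∀ l, TBound θ A (S' l) := fun l => hS.congr (e' l) hθ.le hA
  have hfix : ∀ l j, fixLeg S l j = fun n => S' l (Sum.elim (fun _ => j) n) := fun l j => by
    funext n
    simp only [fixLeg, S']
    congr 1
    funext y
    by_cases h : y = l
    · subst h
      simp [e']
    · simp [e', h]
  refine ⟨fun q l => ∑ i : PUnit.{1} → σ, contr q (tensorPoly fun n => T' (Sum.elim i n))
    (tensorPoly fun n => S' l (Sum.elim i n)), fun q l => ?_, ?_⟩
  · have h := sum_contr_tensorPoly hθ hB hA q hT' (hS' l)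
    simpa using h
  · have hu : ∀ F : (PUnit.{1} → σ) → MvPolynomial σ ℝ, ∑ u, F u = ∑ j, F fun _ => j :=
      fun F => Fintype.sum_equiv (Equiv.punitArrowEquiv σ) _ _ fun u => rfl
    -- Differentiating fixes a leg `l` of `S` and leaves `k - 1` legs, so orders `q < k` suffice in
    -- the product formula.
    have hpd : ∀ j, wick (tensorPoly fun n => T' (Sum.elim (fun _ => j) n)) *
        wick (pderiv j (tensorPoly S)) = ∑ q ∈ Finset.range k, ∑ l : Fin k,
          ((q.factorial : ℝ)⁻¹) • wick (contr q (tensorPoly fun n => T' (Sum.elim (fun _ => j) n))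
            (tensorPoly fun n => S' l (Sum.elim (fun _ => j) n))) := fun j => by
      rw [pderiv_tensorPoly, map_sum, Finset.mul_sum, Finset.sum_comm]
      refine Finset.sum_congr rfl fun l _ => ?_
      rw [wick_mul_wick k, map_sum]
      · simp only [map_smul, hfix]
      · intro q hq f
        refine contr_tensorPoly_eq_zero q ?_ f _
        have := l.2
        simp
        omega
    rw [← tensorPoly_congr e T, tensorPoly_punit_sum, map_sum, Finset.sum_mul, map_sum]
    -- The derivative falls on one of the `u + 1` equal copies, whence the factor `u + 1`.
    simp_rw [expect_wick_X_mul_mul, Derivation.leibniz_pow, pderiv_wick, hu, map_sum,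
      Finset.sum_mul, map_sum]
    simp only [Finset.mul_sum]
    calc _ = ∑ j : σ, ∑ q ∈ Finset.range k, ∑ l : Fin k, ((u : ℝ) + 1) * (((q.factorial : ℝ)⁻¹) *
          expect (wick (contr q (tensorPoly fun n => T' (Sum.elim (fun _ => j) n))
            (tensorPoly fun n => S' l (Sum.elim (fun _ => j) n))) * wick (tensorPoly S) ^ u)) := by
          refine Finset.sum_congr rfl fun j _ => ?_
          have : ∀ P Q G : MvPolynomial σ ℝ, expect (P * ((u + 1) • G ^ u • Q)) =
              ((u : ℝ) + 1) * expect ((P * Q) * G ^ u) := fun P Q G => by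
            rw [mul_smul_comm, map_nsmul, nsmul_eq_mul, smul_eq_mul]
            push_cast
            ring_nf
          rw [Nat.add_sub_cancel, this, hpd, Finset.sum_mul, map_sum, Finset.mul_sum]
          refine Finset.sum_congr rfl fun q _ => ?_
          rw [Finset.sum_mul, map_sum, Finset.mul_sum]
          refine Finset.sum_congr rfl fun l _ => ?_
          rw [smul_mul_assoc, map_smul, smul_eq_mul]
      _ = _ := by
          rw [Finset.sum_comm]
          refine Finset.sum_congr rfl fun q _ => ?_
          rw [Finset.sum_comm]

/-- The growth function in the bound on the moments. -/
def growth (k : ℕ) (s : ℝ) (o : ℕ) : ℝ := if o = 0 then 1 else s ^ 2 * s ^ (o - k) / s ^ k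

theorem growth_pos {k : ℕ} {s : ℝ} (hs : 0 < s) (o : ℕ) : 0 < growth k s o := by
  unfold growth
  split_ifs <;> positivity

/-- The potential inequality for one merge: the `q` extra pairings offer at most `(2k s²)^q` choices
in `f`, and losing `2q` legs pays for `s^(2q)`. When few legs are present the choices are bounded by
a constant. -/
theorem descFactorial_mul_growth_le {k : ℕ} (hk : 2 ≤ k) {s : ℝ} (hs : 1 ≤ s) {o q : ℕ}
    (hq : q < k) (_ : q ≤ o) (ho : ((o + 1 : ℕ) : ℝ) ≤ 2 * k * s ^ 2) :
    (o.descFactorial q : ℝ) * growth k s (o + (k - 1) - 2 * q) ≤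
      (2 * k) ^ k * (s ^ k / s ^ 2 * growth k s (o + 1)) := by
  have hs0 : 0 < s := by linarith
  have hk1 : (1 : ℝ) ≤ 2 * k := by
    have : (2 : ℝ) ≤ k := by exact_mod_cast hk
    linarith
  have hd : (o.descFactorial q : ℝ) ≤ ((o + 1 : ℕ) : ℝ) ^ q := by
    exact_mod_cast (Nat.descFactorial_le_pow o q).trans (Nat.pow_le_pow_left (Nat.le_succ o) q)
  have hr : s ^ k / s ^ 2 * growth k s (o + 1) = s ^ (o + 1 - k) := by
    rw [growth, if_neg (Nat.succ_ne_zero o)]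
    field_simp
  rw [hr]
  have hsm : ((o + 1 : ℕ) : ℝ) ≤ 2 * k → (o.descFactorial q : ℝ) ≤ (2 * k) ^ k := fun h =>
    hd.trans ((pow_le_pow_left₀ (by positivity) h q).trans (pow_le_pow_right₀ hk1 hq.le))
  rcases Nat.eq_zero_or_pos (o + (k - 1) - 2 * q) with h0 | h0
  · rw [h0, growth, if_pos rfl, mul_one]
    -- No leg survives, so `o + k - 1 ≤ 2q ≤ 2k - 2`.
    have : ((o + 1 : ℕ) : ℝ) ≤ 2 * k := by
      exact_mod_cast (show o + 1 ≤ 2 * k by omega)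
    exact (hsm this).trans (le_mul_of_one_le_right (by positivity) (one_le_pow₀ hs))
  · rw [growth, if_neg h0.ne', mul_div_assoc', div_le_iff₀ (by positivity), mul_assoc,
      ← pow_add, ← pow_add]
    by_cases h : o + 1 ≤ 2 * k
    · refine mul_le_mul (hsm (by exact_mod_cast h)) (pow_le_pow_right₀ hs (by omega))
        (by positivity) (by positivity)
    -- Now `o ≥ 2k > 2q`, so the subtractions are not truncated and the powers of `s` balance
    -- exactly.
    · have h1 : (o.descFactorial q : ℝ) ≤ (2 * k) ^ k * s ^ (2 * q) := by
        refine hd.trans ((pow_le_pow_left₀ (by positivity) ho q).trans ?_)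
        rw [mul_pow, ← pow_mul]
        exact mul_le_mul_of_nonneg_right (pow_le_pow_right₀ hk1 hq.le) (by positivity)
      refine (mul_le_mul_of_nonneg_right h1 (by positivity)).trans ?_
      rw [mul_assoc, ← pow_add]
      exact mul_le_mul_of_nonneg_left (pow_le_pow_right₀ hs (by omega)) (by positivity)

/-- The constant in the moment bound. -/
def momentConst (k : ℕ) : ℝ := 2 * k * k * 2 ^ k * (2 * k) ^ k

theorem one_le_momentConst {k : ℕ} (hk : 2 ≤ k) : 1 ≤ momentConst k := by
  have hk0 : (2 : ℝ) ≤ k := by exact_mod_cast hk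
  have h1 : (1 : ℝ) ≤ 2 ^ k := one_le_pow₀ (by norm_num)
  have h2 : (1 : ℝ) ≤ (2 * k) ^ k := one_le_pow₀ (by linarith)
  have h3 : (1 : ℝ) ≤ 2 * k * k := by nlinarith
  exact one_le_mul_of_one_le_of_one_le (one_le_mul_of_one_le_of_one_le h3 h1) h2

/-- Starting a new component from a copy of `a` costs no more than an ordinary merge. -/
theorem div_mul_growth_self_le {k : ℕ} (hk : 2 ≤ k) (hθ : 0 < θ) (hA : 0 ≤ A) {s : ℝ}
    (hs : 1 ≤ s) (hsθ : s ^ 2 ≤ s ^ k * s ^ k * θ ^ 2) :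
    A / θ * growth k s k ≤ A * (momentConst k * s ^ k * θ) := by
  have hs0 : 0 < s := by linarith
  rw [growth, if_neg (by omega), Nat.sub_self, pow_zero, mul_one, div_mul_div_comm,
    div_le_iff₀ (by positivity)]
  have h3 : s ^ 2 ≤ momentConst k * (s ^ k * s ^ k * θ ^ 2) :=
    hsθ.trans (le_mul_of_one_le_left (by positivity) (one_le_momentConst hk))
  calc A * s ^ 2 ≤ A * (momentConst k * (s ^ k * s ^ k * θ ^ 2)) :=
        mul_le_mul_of_nonneg_left h3 hA
    _ = _ := by ring

/-- Induction on the number `u` of unexplored copies. The leg budget `huo` keeps `u` below `2s²` and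
`o` below `2k s²`. In `momentConst`, `2` comes from the choice of a copy, `k * k` from the pairs
`(q, l)`, `2 ^ k` from a binomial coefficient, and `(2k)^k` from the potential inequality. -/
theorem abs_expect_wick_mul_pow_le {k : ℕ} (hk : 2 ≤ k) (hθ : 0 < θ) (hA : 0 ≤ A) {s : ℝ}
    (hs : 1 ≤ s) {N : ℕ} (hN : (N : ℝ) = 2 * s ^ 2) (hsθ : s ^ 2 ≤ s ^ k * s ^ k * θ ^ 2)
    {a : MvPolynomial σ ℝ} (ha : HasTensor θ k A a) (u o : ℕ) (huo : k * u + o ≤ k * N)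
    {f : MvPolynomial σ ℝ} (hB : 0 ≤ B) (hf : HasTensor θ o B f) :
    |expect (wick f * wick a ^ u)| ≤
      B / θ * (A * (momentConst k * s ^ k * θ)) ^ u * growth k s o := by
  have hs0 : 0 < s := by linarith
  have hk0 : (2 : ℝ) ≤ k := by exact_mod_cast hk
  have hC1 := one_le_momentConst hk
  have hC0 : 0 < momentConst k := by linarith
  induction u generalizing o B f with
  | zero =>
    obtain ⟨T, hT, rfl⟩ := hf
    rcases o with _ | o
    · have h := hT.abs_le_of_isEmpty
      rw [tensorPoly_of_isEmpty, wick_C, pow_zero, mul_one, expect_C, pow_zero, mul_one, growth,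
        if_pos rfl, mul_one, le_div_iff₀ hθ, mul_comm]
      exact h
    · let e : Fin (o + 1) ≃ PUnit.{1} ⊕ Fin o := Fintype.equivOfCardEq (by simp [add_comm])
      rw [← tensorPoly_congr e T, tensorPoly_punit_sum, pow_zero, mul_one, map_sum, map_sum]
      simp_rw [expect_wick_eq_zero]
      rw [Finset.sum_const_zero, abs_zero]
      have := growth_pos (k := k) hs0 (o + 1)
      positivity
  | succ u ih =>
    set D := A * (momentConst k * s ^ k * θ) with hD
    have hD0 : 0 ≤ D := by positivity
    rcases o with _ | o
    -- Here `f` is a constant: the component is complete, and one copy of `a` becomes the new `f`.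
    · obtain ⟨T, hT, rfl⟩ := hf
      have h := hT.abs_le_of_isEmpty
      have h1 := ih k (by rw [mul_add] at huo; omega) hA ha
      rw [tensorPoly_of_isEmpty, wick_C, pow_succ', ← smul_eq_C_mul, map_smul, smul_eq_mul,
        abs_mul, growth, if_pos rfl, mul_one]
      have h2 : |T isEmptyElim| ≤ B / θ := by rw [le_div_iff₀ hθ, mul_comm]; exact h
      refine (mul_le_mul h2 h1 (abs_nonneg _) (by positivity)).trans ?_
      refine mul_le_mul_of_nonneg_left ?_ (by positivity)
      rw [pow_succ', mul_right_comm]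
      exact mul_le_mul_of_nonneg_right (div_mul_growth_self_le hk hθ hA hs hsθ) (by positivity)
    · obtain ⟨h, hh, heq⟩ := expect_wick_mul_pow_succ hθ hA hB hf ha u
      have hu : ((u : ℝ) + 1) ≤ 2 * s ^ 2 := by
        rw [← hN]
        have : u + 1 ≤ N := Nat.le_of_mul_le_mul_left (by omega : k * (u + 1) ≤ k * N) (by omega)
        exact_mod_cast this
      have ho : ((o + 1 : ℕ) : ℝ) ≤ 2 * k * s ^ 2 := by
        have : ((o + 1 : ℕ) : ℝ) ≤ k * N := by exact_mod_cast (by omega : o + 1 ≤ k * N)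
        rw [hN] at this
        linarith
      have hterm : ∀ q ∈ Finset.range k, ∀ l : Fin k,
          |((q.factorial : ℝ)⁻¹) * expect (wick (h q l) * wick a ^ u)| ≤
            2 ^ k * (2 * k) ^ k * (B * A * D ^ u * (s ^ k / s ^ 2 * growth k s (o + 1))) := by
        intro q hq l
        rw [Finset.mem_range] at hq
        have h1 := ih (o + (k - 1) - 2 * q) (by rw [mul_add] at huo; omega) (by positivity)
          (hh q l)
        rw [abs_mul, abs_of_nonneg (by positivity)]
        refine (mul_le_mul_of_nonneg_left h1 (by positivity)).trans ?_
        by_cases hqo : q ≤ o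
        · have h2 := descFactorial_mul_growth_le hk hs hq hqo ho
          have h3 : (q.factorial : ℝ)⁻¹ * (k - 1).descFactorial q ≤ 2 ^ k := by
            rw [Nat.descFactorial_eq_factorial_mul_choose, Nat.cast_mul, inv_mul_cancel_left₀
              (by positivity)]
            exact_mod_cast (Nat.choose_le_two_pow (k - 1) q).trans
              (Nat.pow_le_pow_right (by norm_num) (by omega))
          have hg := growth_pos (k := k) hs0 (o + 1)
          have hg' := growth_pos (k := k) hs0 (o + (k - 1) - 2 * q)
          calc _ = ((q.factorial : ℝ)⁻¹ * (k - 1).descFactorial q) *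
                (o.descFactorial q * growth k s (o + (k - 1) - 2 * q)) * (B * A * D ^ u) := by
                field_simp
            _ ≤ 2 ^ k * ((2 * k) ^ k * (s ^ k / s ^ 2 * growth k s (o + 1))) *
                (B * A * D ^ u) := by
                refine mul_le_mul_of_nonneg_right (mul_le_mul h3 h2 (by positivity)
                  (by positivity)) (by positivity)
            _ = _ := by ring
        · rw [Nat.descFactorial_of_lt (by omega)]
          have hg := growth_pos (k := k) hs0 (o + 1)
          simp only [Nat.cast_zero, zero_mul, zero_div, mul_zero]
          positivity
      rw [heq, abs_mul, abs_of_nonneg (by positivity)]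
      have hg := growth_pos (k := k) hs0 (o + 1)
      have hsum : |∑ q ∈ Finset.range k, ∑ l : Fin k,
          ((q.factorial : ℝ)⁻¹) * expect (wick (h q l) * wick a ^ u)| ≤
          k * (k * (2 ^ k * (2 * k) ^ k *
            (B * A * D ^ u * (s ^ k / s ^ 2 * growth k s (o + 1))))) := by
        refine (Finset.abs_sum_le_sum_abs _ _).trans ((Finset.sum_le_card_nsmul _ _ _
          fun q hq => (Finset.abs_sum_le_sum_abs _ _).trans (Finset.sum_le_card_nsmul _ _ _
            fun l _ => hterm q hq l)).trans_eq ?_)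
        simp [nsmul_eq_mul]
      refine (mul_le_mul hu hsum (abs_nonneg _) (by positivity)).trans ?_
      rw [pow_succ D u, hD, momentConst]
      refine le_of_eq ?_
      field_simp

/-- The moment bound for a Wick polynomial whose tensor is bounded. -/
theorem expect_wick_pow_le {k : ℕ} (hk : 2 ≤ k) (hθ : 0 < θ) (hA : 0 ≤ A) {M : ℕ} (hM : 1 ≤ M)
    (hMθ : (M : ℝ) ≤ M ^ k * θ ^ 2) {a : MvPolynomial σ ℝ} (ha : HasTensor θ k A a) :
    expect (wick a ^ (2 * M)) ≤
      (momentConst k ^ 2) ^ M * A ^ (2 * M) * ((M : ℝ) ^ k * θ ^ 2) ^ M := by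
  have hM1 : (1 : ℝ) ≤ M := by exact_mod_cast hM
  have hs : 1 ≤ √(M : ℝ) := Real.one_le_sqrt.mpr hM1
  have hs2 : √(M : ℝ) ^ 2 = M := Real.sq_sqrt (by linarith)
  have hsk : √(M : ℝ) ^ k * √(M : ℝ) ^ k = M ^ k := by rw [← mul_pow, ← sq, hs2]
  have hC0 : 0 < momentConst k := by linarith [one_le_momentConst hk]
  have hsθ : √(M : ℝ) ^ 2 ≤ √(M : ℝ) ^ k * √(M : ℝ) ^ k * θ ^ 2 := by rw [hs2, hsk]; exact hMθ
  -- One of the `2M` copies serves as the initial `f`, which exhausts the leg budget exactly.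
  have h := abs_expect_wick_mul_pow_le hk hθ hA hs (N := 2 * M) (by push_cast; rw [hs2])
    hsθ ha (2 * M - 1) k (by
      obtain ⟨m, rfl⟩ := Nat.exists_eq_add_of_le hM
      rw [show 2 * (1 + m) - 1 = 2 * m + 1 by omega]
      exact le_of_eq (by ring)) hA ha
  rw [← pow_succ', show 2 * M - 1 + 1 = 2 * M by omega] at h
  refine (le_abs_self _).trans (h.trans ?_)
  rw [mul_right_comm]
  refine (mul_le_mul_of_nonneg_right (div_mul_growth_self_le hk hθ hA hs hsθ)
    (by positivity)).trans_eq ?_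
  rw [← pow_succ', show 2 * M - 1 + 1 = 2 * M by omega, ← hsk]
  simp only [pow_mul, ← mul_pow]
  ring

end
end GaussianPolynomial

namespace GaussianPolynomial

/-! ### The quantities `V` -/

section

variable {ι : Type*} {k : ℕ}

theorem abs_le_one_of_mem_testFamilies {P : Finpartition (Finset.univ : Finset (Fin k))}
    {b : (A : P.parts) → ((A.1 → ι) → ℝ)} (hb : b ∈ testFamilies ι P) (A : P.parts)
    (m : A.1 → ι) : |b A m| ≤ 1 := by
  rw [← sq_le_one_iff_abs_le_one]
  exact ((hb A).1.le_tsum m fun _ _ => sq_nonneg _).trans (hb A).2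

theorem bddAbove_testFamilies (a : (Fin k → ι) →₀ ℝ)
    (P : Finpartition (Finset.univ : Finset (Fin k))) :
    BddAbove ((fun b : (A : P.parts) → ((A.1 → ι) → ℝ) =>
      a.sum fun n c => c * ∏ A : P.parts, b A fun j => n j) '' testFamilies ι P) := by
  refine ⟨∑ n ∈ a.support, |a n|, ?_⟩
  rintro _ ⟨b, hb, rfl⟩
  refine Finset.sum_le_sum fun n _ => (le_abs_self _).trans ?_
  rw [abs_mul, Finset.abs_prod]
  exact mul_le_of_le_one_right (abs_nonneg _) (Finset.prod_le_one (fun _ _ => abs_nonneg _)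
    fun A _ => abs_le_one_of_mem_testFamilies hb A _)

theorem le_VPart (a : (Fin k → ι) →₀ ℝ) {P : Finpartition (Finset.univ : Finset (Fin k))}
    {b : (A : P.parts) → ((A.1 → ι) → ℝ)} (hb : b ∈ testFamilies ι P) :
    (a.sum fun n c => c * ∏ A : P.parts, b A fun j => n j) ≤ VPart a P :=
  le_csSup (bddAbove_testFamilies a P) ⟨b, hb, rfl⟩

theorem VPart_le (a : (Fin k → ι) →₀ ℝ) {P : Finpartition (Finset.univ : Finset (Fin k))} {r : ℝ}
    (h : ∀ b ∈ testFamilies ι P, (a.sum fun n c => c * ∏ A : P.parts, b A fun j => n j) ≤ r) :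
    VPart a P ≤ r := by
  refine csSup_le ⟨_, 0, fun A => ?_, rfl⟩ (by rintro _ ⟨b, hb, rfl⟩; exact h b hb)
  simp [summable_zero]

theorem VPart_nonneg (hk : k ≠ 0) (a : (Fin k → ι) →₀ ℝ)
    (P : Finpartition (Finset.univ : Finset (Fin k))) : 0 ≤ VPart a P := by
  have hP : Nonempty P.parts := by
    have : (⟨0, by omega⟩ : Fin k) ∈ (Finset.univ : Finset (Fin k)) := Finset.mem_univ _
    obtain ⟨t, ht, _⟩ := P.exists_mem this
    exact ⟨⟨t, ht⟩⟩
  have h := le_VPart a (P := P) (b := 0) fun A => by simp [summable_zero]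
  refine le_trans (le_of_eq ?_) h
  have hc : P.parts.card ≠ 0 := Finset.card_ne_zero.mpr (Finset.nonempty_coe_sort.mp hP)
  simp [Finsupp.sum, hc]

theorem VPart_le_V (a : (Fin k → ι) →₀ ℝ) (P : Finpartition (Finset.univ : Finset (Fin k))) :
    VPart a P ≤ V P.parts.card a :=
  le_ciSup (f := fun Q : {Q : Finpartition (Finset.univ : Finset (Fin k)) //
    Q.parts.card = P.parts.card} => VPart a Q.1) (Set.finite_range _).bddAbove ⟨P, rfl⟩

theorem V_nonneg (hk : k ≠ 0) (s : ℕ) (a : (Fin k → ι) →₀ ℝ) : 0 ≤ V s a :=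
  Real.iSup_nonneg fun P => VPart_nonneg hk a P.1

/-- The partition into the fibres of a surjective map. -/
def fiberPartition {β : Type} [Fintype β] [DecidableEq β] (c : Fin k → β)
    (hc : Function.Surjective c) : Finpartition (Finset.univ : Finset (Fin k)) :=
  Finpartition.ofExistsUnique (Finset.univ.image fun x => Finset.univ.filter fun l => c l = x)
    (fun _ _ => Finset.subset_univ _)
    (fun l _ => ⟨Finset.univ.filter fun l' => c l' = c l, by simp, by
      rintro t ⟨ht, hl⟩
      obtain ⟨x, _, rfl⟩ := Finset.mem_image.mp ht
      rw [(Finset.mem_filter.mp hl).2]⟩)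
    (fun h => by
      obtain ⟨x, _, hx⟩ := Finset.mem_image.mp h
      obtain ⟨l, rfl⟩ := hc x
      have : l ∈ (∅ : Finset (Fin k)) := hx ▸ (by simp)
      simp at this)

/-- The blocks of the partition into fibres correspond to the values. -/
def fiberEquiv {β : Type} [Fintype β] [DecidableEq β] (c : Fin k → β)
    (hc : Function.Surjective c) : β ≃ (fiberPartition c hc).parts :=
  Equiv.ofBijective (fun x => ⟨Finset.univ.filter fun l => c l = x,
      Finset.mem_image_of_mem _ (Finset.mem_univ x)⟩) (by
    refine ⟨fun x y hxy => ?_, fun ⟨t, ht⟩ => ?_⟩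
    · obtain ⟨l, rfl⟩ := hc x
      have h : l ∈ Finset.univ.filter fun l' => c l' = y := by
        rw [← Subtype.mk.inj hxy]; simp
      simpa using h
    · obtain ⟨x, _, rfl⟩ := Finset.mem_image.mp ht
      exact ⟨x, rfl⟩)

theorem mem_fiber_iff {β : Type} [Fintype β] [DecidableEq β] (c : Fin k → β)
    (hc : Function.Surjective c) (A : (fiberPartition c hc).parts) (l : Fin k) :
    l ∈ A.1 ↔ c l = (fiberEquiv c hc).symm A := by
  obtain ⟨x, rfl⟩ := (fiberEquiv c hc).surjective A
  rw [Equiv.symm_apply_apply]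
  change l ∈ Finset.univ.filter (fun l => c l = x) ↔ _
  simp

theorem card_fiberPartition {β : Type} [Fintype β] [DecidableEq β] (c : Fin k → β)
    (hc : Function.Surjective c) : (fiberPartition c hc).parts.card = Fintype.card β := by
  rw [Fintype.card_congr (fiberEquiv c hc), Fintype.card_coe]

/-- The restriction of an array to a finite set of indices. -/
def restrictTensor (J : Finset ι) (a : (Fin k → ι) →₀ ℝ) (n : Fin k → J) : ℝ := a fun l => n l

theorem sum_eq_sum_restrict {M : Type*} [AddCommMonoid M] [DecidableEq ι] (J : Finset ι)
    {a : (Fin k → ι) →₀ ℝ} (hJ : ∀ n ∈ a.support, ∀ l, n l ∈ J) (F : (Fin k → ι) → ℝ → M)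
    (hF : ∀ n, F n 0 = 0) :
    a.sum F = ∑ n : Fin k → J, F (fun l => n l) (restrictTensor J a n) := by
  rw [Finsupp.sum_of_support_subset a (s := Finset.univ.image fun (n : Fin k → J) l => (n l : ι))
    (fun n hn => Finset.mem_image.mpr ⟨fun l => ⟨n l, hJ n hn l⟩, Finset.mem_univ _, rfl⟩) F
    fun n _ => hF n, Finset.sum_image fun n _ n' _ h => ?_]
  · rfl
  · funext l
    exact Subtype.ext (congrFun h l)

/-- Homogeneity: divide each array by its norm and extend it by zero outside `J`. A zero array makes
the form vanish. -/
theorem sum_restrictTensor_le [DecidableEq ι] (J : Finset ι) {a : (Fin k → ι) →₀ ℝ}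
    (hJ : ∀ n ∈ a.support, ∀ l, n l ∈ J) (hk : k ≠ 0) {β : Type} [Fintype β] [DecidableEq β]
    (c : Fin k → β) (hc : Function.Surjective c) (b : ∀ x, ({l // c l = x} → J) → ℝ) :
    ∑ n, restrictTensor J a n * ∏ x, b x (fun l => n l) ≤
      V (Fintype.card β) a * ∏ x, √(∑ m, b x m ^ 2) := by
  classical
  have hnn : ∀ x, 0 ≤ ∑ m, b x m ^ 2 := fun x => Finset.sum_nonneg fun _ _ => sq_nonneg _
  by_cases h0 : ∃ x, ∑ m, b x m ^ 2 = 0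
  · obtain ⟨x, hx⟩ := h0
    rw [Finset.sum_eq_zero_iff_of_nonneg fun _ _ => sq_nonneg _] at hx
    rw [Finset.sum_eq_zero fun n _ => by
      rw [Finset.prod_eq_zero (Finset.mem_univ x) (pow_eq_zero_iff (two_ne_zero) |>.mp
        (hx _ (Finset.mem_univ _))), mul_zero]]
    exact mul_nonneg (V_nonneg hk _ _) (Finset.prod_nonneg fun _ _ => Real.sqrt_nonneg _)
  · push Not at h0
    set P := fiberPartition c hc
    set e := fiberEquiv c hc
    set w : β → ℝ := fun x => √(∑ m, b x m ^ 2) with hw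
    have hwpos : ∀ x, 0 < w x := fun x => Real.sqrt_pos.mpr ((hnn x).lt_of_ne (h0 x).symm)
    have hmem : ∀ (A : P.parts) (l : {l // c l = e.symm A}), l.1 ∈ A.1 := fun A l =>
      (mem_fiber_iff c hc A l.1).mpr l.2
    let b' : (A : P.parts) → ((A.1 → ι) → ℝ) := fun A m =>
      if h : ∀ l, m l ∈ J then
        b (e.symm A) (fun l => ⟨m ⟨l.1, hmem A l⟩, h _⟩) / w (e.symm A) else 0
    have hb' : b' ∈ testFamilies ι P := fun A => by
      let φ : ({l // c l = e.symm A} → J) → (A.1 → ι) := fun m l =>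
        m ⟨l.1, (mem_fiber_iff c hc A l.1).mp l.2⟩
      have hφ : Function.Injective φ := fun m m' h => by
        funext l
        exact Subtype.ext (congrFun h ⟨l.1, hmem A l⟩)
      have hs : HasSum (fun m => b' A m ^ 2) 1 := by
        rw [← hφ.hasSum_iff]
        · have h1 : ∀ m, ((fun m => b' A m ^ 2) ∘ φ) m = b (e.symm A) m ^ 2 / w (e.symm A) ^ 2 :=
            fun m => by
              have : ∀ l, φ m l ∈ J := fun l => (m _).2
              simp only [Function.comp_apply, b', dif_pos this, div_pow]
              rfl
          have h2 := hasSum_fintype ((fun m => b' A m ^ 2) ∘ φ)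
          simp only [h1] at h2
          rw [← Finset.sum_div, hw, Real.sq_sqrt (hnn _), div_self (h0 _)] at h2
          exact (funext h1) ▸ h2
        · intro m hm
          have : ¬ ∀ l, m l ∈ J := fun h => hm ⟨fun l => ⟨m ⟨l.1, hmem A l⟩, h _⟩, rfl⟩
          simp only [b', dif_neg this]
          norm_num
      exact ⟨hs.summable, hs.tsum_eq.le⟩
    have h := (le_VPart a hb').trans (VPart_le_V a P)
    rw [card_fiberPartition, sum_eq_sum_restrict J hJ _ (by simp)] at h
    have h1 : ∀ n : Fin k → J, ∏ A : P.parts, b' A (fun j => (n j : ι)) =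
        (∏ x, b x fun l => n l) / ∏ x, w x := fun n => by
      rw [← Finset.prod_div_distrib, ← e.symm.prod_comp]
      refine Finset.prod_congr rfl fun A _ => ?_
      exact dif_pos fun l : A.1 => (n l).2
    simp only [h1, mul_div_assoc'] at h
    rw [← Finset.sum_div, div_le_iff₀ (Finset.prod_pos fun x _ => hwpos x)] at h
    exact h

/-- Changing the sign of a single array, on the block of leg `0`, reverses the sign of the form and
keeps all norms. -/
theorem abs_sum_restrictTensor_le [DecidableEq ι] (J : Finset ι) {a : (Fin k → ι) →₀ ℝ}
    (hJ : ∀ n ∈ a.support, ∀ l, n l ∈ J) (hk : k ≠ 0) {β : Type} [Fintype β] [DecidableEq β]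
    (c : Fin k → β) (hc : Function.Surjective c) (b : ∀ x, ({l // c l = x} → J) → ℝ) :
    |∑ n, restrictTensor J a n * ∏ x, b x (fun l => n l)| ≤
      V (Fintype.card β) a * ∏ x, √(∑ m, b x m ^ 2) := by
  refine abs_le'.mpr ⟨sum_restrictTensor_le J hJ hk c hc b, ?_⟩
  have h := sum_restrictTensor_le J hJ hk c hc
    fun x m => (if x = c ⟨0, by omega⟩ then -1 else 1) * b x m
  have h1 : ∀ x : β, (if x = c ⟨0, by omega⟩ then (-1 : ℝ) else 1) ^ 2 = 1 := fun x => by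
    split_ifs <;> norm_num
  simp only [Finset.prod_mul_distrib, Finset.prod_ite_eq', Finset.mem_univ, if_true, mul_pow, h1,
    one_mul, neg_mul, mul_neg, Finset.sum_neg_distrib] at h
  exact h

theorem TBound_restrictTensor [DecidableEq ι] (J : Finset ι) {a : (Fin k → ι) →₀ ℝ}
    (hJ : ∀ n ∈ a.support, ∀ l, n l ∈ J) (hk : k ≠ 0) {θ : ℝ} (hθ : 0 ≤ θ)
    (hV : ∀ s, 2 ≤ s → s ≤ k → V s a ≤ V 1 a * θ ^ (s - 1)) :
    TBound θ (V 1 a) (restrictTensor J a) := by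
  intro β _ _ c hc b
  have h := mul_le_mul_of_nonneg_left (abs_sum_restrictTensor_le J hJ hk c hc b) hθ
  refine h.trans ?_
  rw [← mul_assoc]
  refine mul_le_mul_of_nonneg_right ?_ (Finset.prod_nonneg fun _ _ => Real.sqrt_nonneg _)
  have h1 : 1 ≤ Fintype.card β := Fintype.card_pos_iff.mpr ⟨c ⟨0, by omega⟩⟩
  have h2 : Fintype.card β ≤ k := by simpa using Fintype.card_le_of_surjective c hc
  obtain ⟨s, hs⟩ := Nat.exists_eq_add_of_le' h1
  rw [hs] at h2 ⊢
  rcases s with _ | s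
  · simp [mul_comm]
  · have := mul_le_mul_of_nonneg_left (hV (s + 1 + 1) (by omega) h2) hθ
    refine this.trans_eq ?_
    rw [Nat.add_sub_cancel, pow_succ θ (s + 1)]
    ring

/-- The one-block form tested with `a` itself is `∑ a²`. -/
theorem eq_zero_of_V_one_eq_zero [DecidableEq ι] (hk : k ≠ 0) {a : (Fin k → ι) →₀ ℝ}
    (h : V 1 a = 0) : a = 0 := by
  let J : Finset ι := a.support.biUnion fun n => Finset.univ.image n
  have hJ : ∀ n ∈ a.support, ∀ l, n l ∈ J := fun n hn l =>
    Finset.mem_biUnion.mpr ⟨n, hn, Finset.mem_image_of_mem _ (Finset.mem_univ l)⟩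
  have h1 := sum_restrictTensor_le J hJ hk (β := Unit) (fun _ => ()) (fun _ => ⟨⟨0, by omega⟩, rfl⟩)
    fun _ m => restrictTensor J a fun l => m ⟨l, rfl⟩
  rw [Fintype.card_unit, h, zero_mul] at h1
  simp only [Finset.univ_unique, Finset.prod_singleton] at h1
  have h2 := (Finset.sum_eq_zero_iff_of_nonneg fun n _ => mul_self_nonneg _).mp
    (le_antisymm h1 (Finset.sum_nonneg fun n _ => mul_self_nonneg (restrictTensor J a n)))
  ext n
  by_contra hn
  have hn' := Finsupp.mem_support_iff.mpr hn
  exact hn (mul_self_eq_zero.mp (h2 (fun l => ⟨n l, hJ n hn' l⟩) (Finset.mem_univ _)))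

end
end GaussianPolynomial

namespace GaussianPolynomial

open MvPolynomial

/-! ### Moments and tails of Wick polynomials -/

section

variable {Ω ι : Type*} {k : ℕ}

theorem wick_prod_X {σ : Type*} [Fintype σ] [DecidableEq σ] (n : Fin k → σ) :
    wick (∏ l, X (n l)) = ∏ j, hermiteX j (Finset.univ.filter fun l => n l = j).card := by
  have h : (∏ l, X (n l) : MvPolynomial σ ℝ) = monomial (∑ l, Finsupp.single (n l) 1) 1 := by
    rw [monomial_sum_one]
    rfl
  rw [h, wick_monomial, one_smul]
  refine Finset.prod_congr rfl fun j _ => ?_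
  congr 1
  rw [Finsupp.finsetSum_apply, Finset.card_filter]
  exact Finset.sum_congr rfl fun l _ => Finsupp.single_apply

theorem aeval_wick_prod_X [DecidableEq ι] (J : Finset ι) (ξ : ι → Ω → ℝ) (n : Fin k → J) (ω : Ω) :
    aeval (fun j : J => ξ j ω) (wick (∏ l, X (n l) : MvPolynomial J ℝ)) =
      wickMonomial ξ (fun l => (n l : ι)) ω := by
  rw [wick_prod_X, map_prod, wickMonomial]
  have h1 : Finset.univ.image (fun l => (n l : ι)) ⊆ J := by
    intro i hi
    obtain ⟨l, _, rfl⟩ := Finset.mem_image.mp hi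
    exact (n l).2
  rw [Finset.prod_subset h1, ← Finset.prod_coe_sort J]
  · refine Finset.prod_congr rfl fun j _ => ?_
    have h2 := Polynomial.aeval_algHom_apply
      ((aeval (R := ℝ) fun j : J => ξ j ω).restrictScalars ℤ) (X j)
      (Polynomial.hermite (Finset.univ.filter fun l => n l = j).card)
    rw [AlgHom.restrictScalars_apply, AlgHom.restrictScalars_apply, aeval_X] at h2
    rw [hermiteX, ← h2]
    simp only [Subtype.ext_iff]
  · intro i _ hi
    have : Finset.univ.filter (fun l => (n l : ι) = i) = ∅ := by
      refine Finset.filter_eq_empty_iff.mpr fun l _ hl => hi ?_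
      exact Finset.mem_image.mpr ⟨l, Finset.mem_univ _, hl⟩
    rw [this, Finset.card_empty, Polynomial.hermite_zero, map_one, map_one]

theorem wickPolynomial_eq_aeval [DecidableEq ι] (J : Finset ι) (ξ : ι → Ω → ℝ)
    {a : (Fin k → ι) →₀ ℝ} (hJ : ∀ n ∈ a.support, ∀ l, n l ∈ J) (ω : Ω) :
    wickPolynomial ξ a ω =
      aeval (fun j : J => ξ j ω) (wick (tensorPoly (restrictTensor J a))) := by
  rw [wickPolynomial, sum_eq_sum_restrict J hJ _ (by simp), tensorPoly, map_sum, map_sum]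
  refine Finset.sum_congr rfl fun n _ => ?_
  rw [map_smul, map_smul, aeval_wick_prod_X, smul_eq_mul]

variable [MeasurableSpace Ω] {μ : Measure Ω} [DecidableEq ι]

/-- The polynomial `Z_k ^ p` has a finite expectation, which is given by `expect`. -/
theorem integral_wickPolynomial_pow (J : Finset ι) {ξ : ι → Ω → ℝ}
    (hξ : ∀ i, HasLaw (ξ i) (gaussianReal 0 1) μ) (hind : iIndepFun ξ μ)
    {a : (Fin k → ι) →₀ ℝ} (hJ : ∀ n ∈ a.support, ∀ l, n l ∈ J) (p : ℕ) :
    Integrable (fun ω => wickPolynomial ξ a ω ^ p) μ ∧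
      ∫ ω, wickPolynomial ξ a ω ^ p ∂μ =
        expect (wick (tensorPoly (restrictTensor J a)) ^ p) := by
  have hlaw : HasLaw (fun ω (j : J) => ξ j ω) (stdG J) μ :=
    iIndepFun.hasLaw_pi (fun j : J => hξ j) (hind.precomp Subtype.val_injective)
  have hint := integrable_aeval_stdG (wick (tensorPoly (restrictTensor J a)) ^ p)
  have heq : (fun ω => wickPolynomial ξ a ω ^ p) =
      (fun x => aeval x (wick (tensorPoly (restrictTensor J a)) ^ p)) ∘
        fun ω (j : J) => ξ j ω := by
    funext ω
    rw [wickPolynomial_eq_aeval J ξ hJ, Function.comp_apply, map_pow]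
  rw [heq]
  refine ⟨?_, hlaw.integral_comp hint.aestronglyMeasurable⟩
  rw [← hlaw.map_eq] at hint
  exact hint.comp_aemeasurable hlaw.aemeasurable

theorem wickPolynomial_moment_le (hk : 2 ≤ k) {ξ : ι → Ω → ℝ}
    (hξ : ∀ i, HasLaw (ξ i) (gaussianReal 0 1) μ) (hind : iIndepFun ξ μ)
    (a : (Fin k → ι) →₀ ℝ) {M : ℕ} (hM : 1 ≤ M) :
    Integrable (fun ω => wickPolynomial ξ a ω ^ (2 * M)) μ ∧
      ∫ ω, wickPolynomial ξ a ω ^ (2 * M) ∂μ ≤ (momentConst k ^ 2) ^ M * V 1 a ^ (2 * M) *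
        (max (M : ℝ) ((M : ℝ) ^ k * (Finset.Icc 2 k).sup' (Finset.nonempty_Icc.mpr hk) fun s : ℕ =>
          (V s a / V 1 a) ^ ((2 : ℝ) / ((s : ℝ) - 1)))) ^ M := by
  have hk0 : k ≠ 0 := by omega
  let J : Finset ι := a.support.biUnion fun n => Finset.univ.image n
  have hJ : ∀ n ∈ a.support, ∀ l, n l ∈ J := fun n hn l =>
    Finset.mem_biUnion.mpr ⟨n, hn, Finset.mem_image_of_mem _ (Finset.mem_univ l)⟩
  obtain ⟨h1, h2⟩ := integral_wickPolynomial_pow J hξ hind hJ (2 * M)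
  refine ⟨h1, ?_⟩
  rw [h2]
  set S := (Finset.Icc 2 k).sup' (Finset.nonempty_Icc.mpr hk) fun s : ℕ =>
    (V s a / V 1 a) ^ ((2 : ℝ) / ((s : ℝ) - 1)) with hS
  set Y := max (M : ℝ) ((M : ℝ) ^ k * S) with hY
  have hM0 : (0 : ℝ) < M := by exact_mod_cast hM
  have hMY : (M : ℝ) ≤ Y := le_max_left _ _
  have hY0 : 0 < Y := hM0.trans_le hMY
  -- The smallest `θ` meeting both needs: `M^k θ² = Y` dominates `M`, and `θ²` dominates every
  -- `(V̄_s/V̄_1)^(2/(s-1))`, which is `V̄_s ≤ V̄_1 θ^(s-1)`.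
  set θ := √(Y / (M : ℝ) ^ k) with hθdef
  have hθ : 0 < θ := Real.sqrt_pos.mpr (by positivity)
  have hθ2 : θ ^ 2 = Y / (M : ℝ) ^ k := Real.sq_sqrt (by positivity)
  have hMθ : (M : ℝ) ^ k * θ ^ 2 = Y := by rw [hθ2]; field_simp
  have hV1 := V_nonneg hk0 1 a
  rcases hV1.eq_or_lt with h0 | h0
  · have ha := eq_zero_of_V_one_eq_zero hk0 h0.symm
    subst ha
    have : tensorPoly (restrictTensor J (0 : (Fin k → ι) →₀ ℝ)) = 0 := by
      simp [tensorPoly, restrictTensor]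
    rw [this, map_zero, zero_pow (by omega), map_zero]
    positivity
  have hT : TBound θ (V 1 a) (restrictTensor J a) := by
    refine TBound_restrictTensor J hJ hk0 hθ.le fun s hs hsk => ?_
    set v := V s a / V 1 a with hv
    have hv0 : 0 ≤ v := div_nonneg (V_nonneg hk0 s a) hV1
    have hle : v ^ ((2 : ℝ) / ((s : ℝ) - 1)) ≤ θ ^ 2 := by
      rw [hθ2, le_div_iff₀ (by positivity), mul_comm]
      refine le_trans (mul_le_mul_of_nonneg_left ?_ (by positivity)) (le_max_right _ _)
      exact Finset.le_sup' (fun s : ℕ => (V s a / V 1 a) ^ ((2 : ℝ) / ((s : ℝ) - 1)))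
        (Finset.mem_Icc.mpr ⟨hs, hsk⟩)
    have hpow := pow_le_pow_left₀ (Real.rpow_nonneg hv0 _) hle (s - 1)
    have hs1 : (0 : ℝ) < (s : ℝ) - 1 := by
      have : (2 : ℝ) ≤ s := by exact_mod_cast hs
      linarith
    rw [← Real.rpow_natCast, ← Real.rpow_mul hv0, Nat.cast_sub (by omega), Nat.cast_one,
      div_mul_cancel₀ _ hs1.ne', Real.rpow_two, ← pow_mul, mul_comm 2, pow_mul] at hpow
    have hvle := (pow_le_pow_iff_left₀ hv0 (by positivity) two_ne_zero).mp hpow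
    rwa [hv, div_le_iff₀ h0, mul_comm] at hvle
  have h := expect_wick_pow_le hk hθ hV1 hM (by rw [hMθ]; exact hMY) ⟨_, hT, rfl⟩
  rwa [hMθ] at h

/-- Markov's inequality for the moment of order `2M` with `M = ⌊c m⌋` and `c = 1/(Ce)`. This `c`
makes the bound `e^(-M)`, and rounding down costs the prefactor `e`. -/
theorem wickPolynomial_tail_le_of_moment [IsProbabilityMeasure μ] (hk : 2 ≤ k) {C : ℝ} (hC : 1 ≤ C) {ξ : ι → Ω → ℝ}
    (a : (Fin k → ι) →₀ ℝ)
    (hmom : ∀ M : ℕ, 1 ≤ M → Integrable (fun ω => wickPolynomial ξ a ω ^ (2 * M)) μ ∧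
      ∫ ω, wickPolynomial ξ a ω ^ (2 * M) ∂μ ≤ C ^ M * V 1 a ^ (2 * M) *
        (max (M : ℝ) ((M : ℝ) ^ k * (Finset.Icc 2 k).sup' (Finset.nonempty_Icc.mpr hk) fun s : ℕ =>
          (V s a / V 1 a) ^ ((2 : ℝ) / ((s : ℝ) - 1)))) ^ M) {x : ℝ} (hx : 0 < x) :
    μ.real {ω | x < |wickPolynomial ξ a ω|} ≤
      Real.exp 1 * Real.exp (-(C * Real.exp 1)⁻¹ * min (x ^ 2 / V 1 a ^ 2)
        ((Finset.Icc 2 k).inf' (Finset.nonempty_Icc.mpr hk) fun s : ℕ =>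
          (x / (V 1 a ^ (((s : ℝ) - 2) / ((s : ℝ) - 1)) * V s a ^ ((1 : ℝ) / ((s : ℝ) - 1)))) ^
            ((2 : ℝ) / (k : ℝ)))) := by
  have hk0 : k ≠ 0 := by omega
  set m := min (x ^ 2 / V 1 a ^ 2)
    ((Finset.Icc 2 k).inf' (Finset.nonempty_Icc.mpr hk) fun s : ℕ =>
      (x / (V 1 a ^ (((s : ℝ) - 2) / ((s : ℝ) - 1)) * V s a ^ ((1 : ℝ) / ((s : ℝ) - 1)))) ^
        ((2 : ℝ) / (k : ℝ))) with hm
  have hC0 : 0 < C := by linarith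
  have he : 1 ≤ Real.exp 1 := Real.one_le_exp zero_le_one
  set c := (C * Real.exp 1)⁻¹ with hc
  have hc0 : 0 < c := by positivity
  have hc1 : c ≤ 1 := inv_le_one_of_one_le₀ (one_le_mul_of_one_le_of_one_le hC he)
  have hV1 := V_nonneg hk0 1 a
  rw [← Real.exp_add]
  -- For `c * m < 1` the prefactor `e` makes the bound trivial. Vanishing `V̄_1` or `V̄_s` also
  -- falls here: division by zero gives `0`, so `m ≤ 0`.
  rcases lt_or_ge (c * m) 1 with hlt | hge
  · refine (measureReal_le_one).trans ?_
    rw [Real.one_le_exp_iff]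
    linarith
  set M := ⌊c * m⌋₊ with hMdef
  have hM : 1 ≤ M := Nat.one_le_floor_iff (c * m) |>.mpr hge
  have hMle : (M : ℝ) ≤ c * m := Nat.floor_le (by linarith)
  have hMgt : c * m < M + 1 := Nat.lt_floor_add_one _
  have hm0 : 0 < m := (mul_pos_iff_of_pos_left hc0).mp (by linarith)
  have hm1 : m ≤ x ^ 2 / V 1 a ^ 2 := min_le_left _ _
  have hV1pos : 0 < V 1 a := by
    refine hV1.lt_of_ne fun h => ?_
    rw [← h] at hm1
    simp at hm1
    linarith
  have hmax : max (M : ℝ) ((M : ℝ) ^ k * (Finset.Icc 2 k).sup' (Finset.nonempty_Icc.mpr hk)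
      fun s : ℕ => (V s a / V 1 a) ^ ((2 : ℝ) / ((s : ℝ) - 1))) ≤ c * (x ^ 2 / V 1 a ^ 2) := by
    refine max_le (hMle.trans (mul_le_mul_of_nonneg_left hm1 hc0.le)) ?_
    rw [← le_div_iff₀' (by positivity)]
    refine Finset.sup'_le _ _ fun s hs => ?_
    rw [le_div_iff₀' (by positivity)]
    have hs2 : (2 : ℝ) ≤ s := by exact_mod_cast (Finset.mem_Icc.mp hs).1
    have hs1 : (0 : ℝ) < (s : ℝ) - 1 := by linarith
    have hVs := V_nonneg hk0 s a
    set D := V 1 a ^ (((s : ℝ) - 2) / ((s : ℝ) - 1)) * V s a ^ ((1 : ℝ) / ((s : ℝ) - 1)) with hD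
    have hD0 : 0 ≤ D := by positivity
    have hms : m ≤ (x / D) ^ ((2 : ℝ) / (k : ℝ)) := (min_le_right _ _).trans
      (Finset.inf'_le (fun s : ℕ => (x / (V 1 a ^ (((s : ℝ) - 2) / ((s : ℝ) - 1)) *
        V s a ^ ((1 : ℝ) / ((s : ℝ) - 1)))) ^ ((2 : ℝ) / (k : ℝ))) hs)
    have hkR : (k : ℝ) ≠ 0 := by exact_mod_cast hk0
    have hDpos : 0 < D := by
      refine hD0.lt_of_ne fun h => ?_
      rw [← h, div_zero, Real.zero_rpow (by positivity)] at hms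
      linarith
    -- The power `k` cancels the exponent `2/k`, and `c^k ≤ c` because `c ≤ 1`.
    have hMk : (M : ℝ) ^ k ≤ c * (x / D) ^ 2 := by
      have h1 : (M : ℝ) ^ k ≤ (c * (x / D) ^ ((2 : ℝ) / (k : ℝ))) ^ k :=
        pow_le_pow_left₀ (by positivity) (hMle.trans (mul_le_mul_of_nonneg_left hms hc0.le)) k
      rw [mul_pow, ← Real.rpow_natCast (_ ^ _), ← Real.rpow_mul (by positivity),
        div_mul_cancel₀ _ hkR, Real.rpow_two] at h1
      exact h1.trans (mul_le_mul_of_nonneg_right (pow_le_of_le_one hc0.le hc1 hk0) (by positivity))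
    have hD2 : D ^ 2 = V 1 a ^ 2 * (V s a / V 1 a) ^ ((2 : ℝ) / ((s : ℝ) - 1)) := by
      have e1 : ((s : ℝ) - 2) / ((s : ℝ) - 1) * 2 = 2 - 2 / ((s : ℝ) - 1) := by
        field_simp
        ring
      have e2 : (1 : ℝ) / ((s : ℝ) - 1) * 2 = 2 / ((s : ℝ) - 1) := by ring
      rw [hD, mul_pow, ← Real.rpow_two, ← Real.rpow_two, ← Real.rpow_mul hV1, ← Real.rpow_mul hVs,
        e1, e2, Real.rpow_sub hV1pos, Real.div_rpow hVs hV1, Real.rpow_two]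
      ring
    calc (M : ℝ) ^ k * (V s a / V 1 a) ^ ((2 : ℝ) / ((s : ℝ) - 1))
        ≤ c * (x / D) ^ 2 * (V s a / V 1 a) ^ ((2 : ℝ) / ((s : ℝ) - 1)) :=
          mul_le_mul_of_nonneg_right hMk (by positivity)
      _ = c * (x ^ 2 / V 1 a ^ 2) := by
          have hD2' : D ^ 2 ≠ 0 := by positivity
          rw [div_pow, hD2] at *
          have : (V s a / V 1 a) ^ ((2 : ℝ) / ((s : ℝ) - 1)) ≠ 0 := right_ne_zero_of_mul hD2'
          field_simp
  obtain ⟨hint, hle⟩ := hmom M hM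
  have hmark : x ^ (2 * M) * μ.real {ω | x < |wickPolynomial ξ a ω|} ≤
      ∫ ω, wickPolynomial ξ a ω ^ (2 * M) ∂μ := by
    refine le_trans (mul_le_mul_of_nonneg_left (measureReal_mono ?_) (by positivity))
      (mul_meas_ge_le_integral_of_nonneg
      (Filter.Eventually.of_forall fun ω => (even_two_mul M).pow_nonneg _) hint (x ^ (2 * M)))
    intro ω hω
    simp only [Set.mem_ofPred_eq] at hω ⊢
    rw [← (even_two_mul M).pow_abs (wickPolynomial ξ a ω)]
    exact pow_le_pow_left₀ hx.le hω.le _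
  have hfin : x ^ (2 * M) * μ.real {ω | x < |wickPolynomial ξ a ω|} ≤
      x ^ (2 * M) * (Real.exp (-1)) ^ M := by
    refine hmark.trans (hle.trans ?_)
    refine (mul_le_mul_of_nonneg_left (pow_le_pow_left₀ (le_max_of_le_left (by positivity)) hmax M)
      (by positivity)).trans_eq ?_
    rw [pow_mul, pow_mul, ← mul_pow, ← mul_pow, ← mul_pow]
    congr 1
    rw [hc, Real.exp_neg]
    field_simp
  refine (le_of_mul_le_mul_left hfin (by positivity)).trans ?_
  rw [← Real.exp_nat_mul, Real.exp_le_exp]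
  linarith

end
end GaussianPolynomial

namespace GaussianPolynomial

/-! ### Quadratic forms -/

section

variable {n : ℕ}

theorem sum_matrixCoeff {M : Type*} [AddCommMonoid M] (A : Matrix (Fin n) (Fin n) ℝ)
    (F : (Fin 2 → Fin n) → ℝ → M) (hF : ∀ p, F p 0 = 0) :
    (matrixCoeff A).sum F = ∑ i, ∑ j, F ![i, j] (A i j) := by
  rw [Finsupp.sum_fintype _ _ hF, ← (finTwoArrowEquiv (Fin n)).symm.sum_comp,
    Fintype.sum_prod_type]
  rfl

theorem wickMonomial_two {Ω : Type*} (ξ : Fin n → Ω → ℝ) (i j : Fin n) (ω : Ω) :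
    wickMonomial ξ ![i, j] ω = ξ i ω * ξ j ω - if i = j then 1 else 0 := by
  have h2 : Polynomial.hermite 2 = Polynomial.X ^ 2 - 1 := by
    rw [Polynomial.hermite_succ, Polynomial.hermite_one, Polynomial.derivative_X, sq]
  have himg : Finset.univ.image ![i, j] = {i, j} := by
    ext l
    simp [Fin.exists_fin_two, eq_comm]
  rw [wickMonomial, himg]
  by_cases h : i = j
  · subst h
    have hc : (Finset.univ.filter fun l => ![i, i] l = i).card = 2 := by
      rw [Finset.filter_true_of_mem fun l _ => by fin_cases l <;> rfl]
      rfl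
    simp only [Finset.pair_eq_singleton, Finset.prod_singleton, hc, h2, if_true]
    simp [sq]
  · have hc1 : (Finset.univ.filter fun l => ![i, j] l = i) = {0} := by
      ext l
      fin_cases l <;> simp [Ne.symm h]
    have hc2 : (Finset.univ.filter fun l => ![i, j] l = j) = {1} := by
      ext l
      fin_cases l <;> simp [h]
    rw [Finset.prod_pair h, hc1, hc2, if_neg h]
    simp

theorem integral_mul_gaussian {Ω : Type*} [MeasurableSpace Ω] {μ : Measure Ω}
    {ξ : Fin n → Ω → ℝ} (hξ : ∀ i, HasLaw (ξ i) (gaussianReal 0 1) μ) (hind : iIndepFun ξ μ)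
    (i j : Fin n) : ∫ ω, ξ i ω * ξ j ω ∂μ = if i = j then 1 else 0 := by
  by_cases h : i = j
  · subst h
    rw [if_pos rfl]
    have h1 := (hξ i).integral_comp (f := fun x : ℝ => x ^ 2)
      (by fun_prop : Continuous fun x : ℝ => x ^ 2).aestronglyMeasurable
    rw [integral_pow_succ_gaussianReal 1] at h1
    simpa [Function.comp_def, sq] using h1
  · rw [if_neg h, (hind.indepFun h).integral_fun_mul_eq_mul_integral
      (hξ i).aemeasurable.aestronglyMeasurable (hξ j).aemeasurable.aestronglyMeasurable,
      (hξ i).integral_eq, integral_id_gaussianReal, zero_mul]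

theorem wickPolynomial_matrixCoeff {Ω : Type*} [MeasurableSpace Ω] {μ : Measure Ω}
    {ξ : Fin n → Ω → ℝ} (hξ : ∀ i, HasLaw (ξ i) (gaussianReal 0 1) μ) (hind : iIndepFun ξ μ)
    (A : Matrix (Fin n) (Fin n) ℝ) :
    wickPolynomial ξ (matrixCoeff A) = centeredForm μ ξ A := by
  funext ω
  rw [wickPolynomial, sum_matrixCoeff _ _ (by simp), centeredForm]
  refine Finset.sum_congr rfl fun i _ => Finset.sum_congr rfl fun j _ => ?_
  rw [wickMonomial_two, integral_mul_gaussian hξ hind]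

/-- Cauchy–Schwarz against the product of the test arrays. The blocks cover all legs, so the squares
of this product sum to at most the product of the separate sums. -/
theorem V_le_sqrt_sum_sq {ι : Type*} [Fintype ι] {k : ℕ} (s : ℕ) (a : (Fin k → ι) →₀ ℝ) :
    V s a ≤ √(∑ p, a p ^ 2) := by
  classical
  refine Real.iSup_le (fun P => VPart_le a fun b hb => ?_) (Real.sqrt_nonneg _)
  rw [Finsupp.sum_fintype _ _ (by simp)]
  refine (Real.sum_mul_le_sqrt_mul_sqrt _ _ _).trans (mul_le_of_le_one_right
    (Real.sqrt_nonneg _) (Real.sqrt_le_one.mpr ?_))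
  have h1 : ∏ A : P.1.parts, ∑ m, b A m ^ 2 ≤ 1 :=
    Finset.prod_le_one (fun _ _ => Finset.sum_nonneg fun _ _ => sq_nonneg _) fun A _ => by
      rw [← tsum_fintype (L := SummationFilter.unconditional _)]; exact (hb A).2
  refine le_trans ?_ h1
  rw [Finset.prod_univ_sum, Fintype.piFinset_univ]
  simp_rw [← Finset.prod_pow]
  refine sum_comp_le_of_injective (φ := fun (p : Fin k → ι) (A : P.1.parts) (j : A.1) => p j)
    (F := fun m => ∏ A : P.1.parts, b A (m A) ^ 2) (fun p p' h => ?_)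
    fun m => Finset.prod_nonneg fun _ _ => sq_nonneg _
  funext l
  obtain ⟨t, ht, hl⟩ := P.1.exists_mem (Finset.mem_univ l)
  exact congrFun (congrFun h ⟨t, ht⟩) ⟨l, hl⟩

/-- Cauchy–Schwarz gives one direction; testing with the matrix itself gives the other. -/
theorem V_one_matrixCoeff (A : Matrix (Fin n) (Fin n) ℝ) :
    V 1 (matrixCoeff A) ^ 2 = ∑ i, ∑ j, A i j ^ 2 := by
  have hsum : ∑ p, matrixCoeff A p ^ 2 = ∑ i, ∑ j, A i j ^ 2 := by
    rw [← sum_matrixCoeff A (fun _ c => c ^ 2) (by simp), Finsupp.sum_fintype _ _ (by simp)]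
  have hJ : ∀ p ∈ (matrixCoeff A).support, ∀ l, p l ∈ (Finset.univ : Finset (Fin n)) :=
    fun _ _ _ => Finset.mem_univ _
  have h := sum_restrictTensor_le Finset.univ hJ two_ne_zero (β := Unit) (fun _ => ())
    (fun _ => ⟨0, rfl⟩) fun _ m => restrictTensor Finset.univ (matrixCoeff A) fun l => m ⟨l, rfl⟩
  have h1 : ∑ m, restrictTensor Finset.univ (matrixCoeff A) m ^ 2 = ∑ i, ∑ j, A i j ^ 2 := by
    rw [← sum_matrixCoeff A (fun _ c => c ^ 2) (by simp), sum_eq_sum_restrict _ hJ _ (by simp)]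
  have h2 : ∑ m : {l : Fin 2 // () = ()} → (Finset.univ : Finset (Fin n)),
      restrictTensor Finset.univ (matrixCoeff A) (fun l => m ⟨l, rfl⟩) ^ 2 ≤
        ∑ i, ∑ j, A i j ^ 2 := by
    rw [← h1]
    refine sum_comp_le_of_injective (φ := fun (m : {l : Fin 2 // () = ()} →
      (Finset.univ : Finset (Fin n))) (l : Fin 2) => m ⟨l, rfl⟩)
      (F := fun m => restrictTensor Finset.univ (matrixCoeff A) m ^ 2) (fun m m' hm => ?_)
      fun _ => sq_nonneg _
    funext l
    exact congrFun hm l.1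
  have hV := V_nonneg two_ne_zero 1 (matrixCoeff A)
  have hle := V_le_sqrt_sum_sq 1 (matrixCoeff A)
  rw [hsum] at hle
  set Λ := ∑ i, ∑ j, A i j ^ 2 with hΛ
  have hΛ0 : 0 ≤ Λ := Finset.sum_nonneg fun _ _ => Finset.sum_nonneg fun _ _ => sq_nonneg _
  simp only [Finset.univ_unique, Finset.prod_singleton, ← sq, Fintype.card_unit] at h
  rw [h1] at h
  have h3 : Λ ≤ V 1 (matrixCoeff A) * √Λ :=
    h.trans (mul_le_mul_of_nonneg_left (Real.sqrt_le_sqrt h2) hV)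
  have hge : √Λ ≤ V 1 (matrixCoeff A) := by
    rcases hΛ0.eq_or_lt with h0 | h0
    · rw [← h0, Real.sqrt_zero]; exact hV
    · refine le_of_mul_le_mul_right ?_ (Real.sqrt_pos.mpr h0)
      rwa [Real.mul_self_sqrt hΛ0]
  rw [le_antisymm hle hge, Real.sq_sqrt hΛ0]

theorem sum_mul_mul_eq_inner (A : Matrix (Fin n) (Fin n) ℝ) (u w : EuclideanSpace ℝ (Fin n)) :
    ∑ i, ∑ j, A i j * (u i * w j) = inner ℝ u (Matrix.toEuclideanCLM (𝕜 := ℝ) A w) := by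
  simp only [PiLp.inner_apply, Matrix.ofLp_toEuclideanCLM, Matrix.mulVec, dotProduct]
  refine Finset.sum_congr rfl fun i _ => ?_
  simp only [RCLike.inner_apply, conj_trivial, Finset.sum_mul]
  exact Finset.sum_congr rfl fun j _ => by ring

/-- Two blocks of a two-element set are singletons, so the form is `⟨u, Aw⟩`. Conversely, testing
with `Aw` and `w` gives `|Aw|² ≤ V̄_2 |Aw| |w|`. -/
theorem V_two_matrixCoeff (A : Matrix (Fin n) (Fin n) ℝ) :
    V 2 (matrixCoeff A) = ‖Matrix.toEuclideanCLM (𝕜 := ℝ) A‖ := by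
  refine le_antisymm (Real.iSup_le (fun ⟨P, hP⟩ => VPart_le _ fun b hb => ?_) (norm_nonneg _)) ?_
  · have hpart : ∀ t ∈ P.parts, t = P.part 0 ∨ t = P.part 1 := fun t ht => by
      obtain ⟨l, hl⟩ := P.nonempty_of_mem_parts ht
      have := P.part_eq_of_mem ht hl
      fin_cases l
      · exact Or.inl this.symm
      · exact Or.inr this.symm
    have hmem : ∀ l, P.part l ∈ P.parts := fun l => P.part_mem.mpr (Finset.mem_univ l)
    have hne : P.part 0 ≠ P.part 1 := fun h => by
      have : P.parts ⊆ {P.part 1} := fun t ht => by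
        rcases hpart t ht with rfl | rfl
        · simp [h]
        · simp
      have := Finset.card_le_card this
      rw [hP, Finset.card_singleton] at this
      omega
    have hsing : ∀ l, ∀ j : (P.part l : Finset (Fin 2)), j.1 = l := fun l ⟨j, hj⟩ => by
      have h := P.part_eq_of_mem (hmem l) hj
      fin_cases l <;> fin_cases j
      · rfl
      · exact absurd h.symm hne
      · exact absurd h hne
      · rfl
    let u : Fin 2 → Fin n → ℝ := fun l i => b ⟨P.part l, hmem l⟩ fun _ => i
    have hu : ∀ l, ∑ i, u l i ^ 2 ≤ 1 := fun l => by
      refine le_trans ?_ (hb ⟨P.part l, hmem l⟩).2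
      rw [tsum_fintype]
      refine sum_comp_le_of_injective (φ := fun (i : Fin n) (_ : (P.part l : Finset (Fin 2))) => i)
        (F := fun m => b ⟨P.part l, hmem l⟩ m ^ 2) (fun i i' h => ?_) fun _ => sq_nonneg _
      exact congrFun h ⟨l, P.mem_part (Finset.mem_univ l)⟩
    have hprod : ∀ p : Fin 2 → Fin n, ∏ B : P.parts, b B (fun j => p j) =
        u 0 (p 0) * u 1 (p 1) := fun p => by
      have huniv : (Finset.univ : Finset P.parts) =
          {⟨P.part 0, hmem 0⟩, ⟨P.part 1, hmem 1⟩} := by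
        ext ⟨t, ht⟩
        simpa using hpart t ht
      rw [huniv, Finset.prod_pair (by simpa using hne)]
      congr 1
      · exact congrArg _ (funext fun j => congrArg p (hsing 0 j))
      · exact congrArg _ (funext fun j => congrArg p (hsing 1 j))
    have hnorm : ∀ l, ‖WithLp.toLp 2 (u l)‖ ≤ 1 := fun l => by
      rw [EuclideanSpace.norm_eq]
      refine Real.sqrt_le_one.mpr ?_
      simpa using hu l
    rw [sum_matrixCoeff _ _ (by simp)]
    simp only [hprod]
    have h := sum_mul_mul_eq_inner A (WithLp.toLp 2 (u 0)) (WithLp.toLp 2 (u 1))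
    refine (le_of_eq h).trans ((real_inner_le_norm _ _).trans ?_)
    calc _ ≤ 1 * (‖Matrix.toEuclideanCLM (𝕜 := ℝ) A‖ * 1) :=
          mul_le_mul (hnorm 0) ((ContinuousLinearMap.le_opNorm _ _).trans
            (mul_le_mul_of_nonneg_left (hnorm 1) (norm_nonneg _))) (norm_nonneg _) zero_le_one
      _ = _ := by ring
  · have hV := V_nonneg two_ne_zero 2 (matrixCoeff A)
    refine ContinuousLinearMap.opNorm_le_bound _ hV fun w => ?_
    set v := Matrix.toEuclideanCLM (𝕜 := ℝ) A w with hv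
    have hJ : ∀ p ∈ (matrixCoeff A).support, ∀ l, p l ∈ (Finset.univ : Finset (Fin n)) :=
      fun _ _ _ => Finset.mem_univ _
    let z : Fin 2 → EuclideanSpace ℝ (Fin n) := ![v, w]
    have h := sum_restrictTensor_le Finset.univ hJ two_ne_zero (β := Fin 2) id
      Function.surjective_id fun x m => z x (m ⟨x, rfl⟩)
    have h1 : ∑ p, restrictTensor Finset.univ (matrixCoeff A) p *
        ∏ x, z x ((p x : Fin n)) = ‖v‖ * ‖v‖ := by
      have hvv := sum_mul_mul_eq_inner A v w
      rw [← hv, real_inner_self_eq_norm_mul_norm] at hvv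
      rw [← hvv, ← sum_eq_sum_restrict Finset.univ hJ
        (fun p c => c * ∏ x, z x (p x)) (by simp), sum_matrixCoeff _ _ (by simp)]
      simp [z, Fin.prod_univ_two]
    have h2 : ∀ x, √(∑ m : {l : Fin 2 // id l = x} → (Finset.univ : Finset (Fin n)),
        z x (m ⟨x, rfl⟩) ^ 2) ≤ ‖z x‖ := fun x => by
      rw [EuclideanSpace.norm_eq]
      refine Real.sqrt_le_sqrt ?_
      simp only [Real.norm_eq_abs, sq_abs]
      refine sum_comp_le_of_injective (φ := fun (m : {l : Fin 2 // id l = x} →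
        (Finset.univ : Finset (Fin n))) => (m ⟨x, rfl⟩ : Fin n))
        (F := fun i => z x i ^ 2) (fun m m' hm => ?_) fun _ => sq_nonneg _
      funext ⟨l, hl⟩
      subst hl
      exact Subtype.ext hm
    have h3 : ‖v‖ * ‖v‖ ≤ V 2 (matrixCoeff A) * (‖v‖ * ‖w‖) := by
      rw [← h1]
      refine h.trans (mul_le_mul_of_nonneg_left ?_ hV)
      refine (Finset.prod_le_prod (fun _ _ => Real.sqrt_nonneg _) fun x _ => h2 x).trans_eq ?_
      simp [z, Fin.prod_univ_two]
    rcases (norm_nonneg v).eq_or_lt with h0 | h0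
    · rw [← h0]; positivity
    · refine le_of_mul_le_mul_left ?_ h0
      linarith

end
end GaussianPolynomial

end

theorem mainTheorem3 :
    (∀ (k : ℕ) (hk : 2 ≤ k), ∃ C C₁ C₂ : ℝ, 0 < C ∧ 0 < C₁ ∧ 0 < C₂ ∧
      ∀ {Ω ι : Type*} [MeasurableSpace Ω] [DecidableEq ι] (μ : Measure Ω)
        [IsProbabilityMeasure μ] (ξ : ι → Ω → ℝ),
        (∀ i, HasLaw (ξ i) (gaussianReal 0 1) μ) → iIndepFun ξ μ →
        ∀ a : (Fin k → ι) →₀ ℝ,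
          (∀ M : ℕ, 1 ≤ M →
            Integrable (fun ω => GaussianPolynomial.wickPolynomial ξ a ω ^ (2 * M)) μ ∧
            ∫ ω, GaussianPolynomial.wickPolynomial ξ a ω ^ (2 * M) ∂μ ≤
              C ^ M * GaussianPolynomial.V 1 a ^ (2 * M) *
                (max (M : ℝ) ((M : ℝ) ^ k *
                  (Finset.Icc 2 k).sup' (Finset.nonempty_Icc.mpr hk) fun s : ℕ =>
                    (GaussianPolynomial.V s a / GaussianPolynomial.V 1 a) ^
                      ((2 : ℝ) / ((s : ℝ) - 1)))) ^ M) ∧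
          (∀ x : ℝ, 0 < x →
            μ.real {ω | x < |GaussianPolynomial.wickPolynomial ξ a ω|} ≤
              C₁ * Real.exp (-C₂ * min (x ^ 2 / GaussianPolynomial.V 1 a ^ 2)
                ((Finset.Icc 2 k).inf' (Finset.nonempty_Icc.mpr hk) fun s : ℕ =>
                  (x / (GaussianPolynomial.V 1 a ^ (((s : ℝ) - 2) / ((s : ℝ) - 1)) *
                    GaussianPolynomial.V s a ^ ((1 : ℝ) / ((s : ℝ) - 1)))) ^
                      ((2 : ℝ) / (k : ℝ)))))) ∧
    (∃ C₁ C₂ : ℝ, 0 < C₁ ∧ 0 < C₂ ∧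
      ∀ {Ω : Type*} [MeasurableSpace Ω] (μ : Measure Ω) [IsProbabilityMeasure μ]
        (n : ℕ) (ξ : Fin n → Ω → ℝ),
        (∀ i, HasLaw (ξ i) (gaussianReal 0 1) μ) → iIndepFun ξ μ →
        ∀ A : Matrix (Fin n) (Fin n) ℝ, A.IsSymm →
          GaussianPolynomial.wickPolynomial ξ (GaussianPolynomial.matrixCoeff A) =
            GaussianPolynomial.centeredForm μ ξ A ∧
          GaussianPolynomial.V 1 (GaussianPolynomial.matrixCoeff A) ^ 2 =
            ∑ i, ∑ j, A i j ^ 2 ∧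
          GaussianPolynomial.V 2 (GaussianPolynomial.matrixCoeff A) =
            ‖Matrix.toEuclideanCLM (𝕜 := ℝ) A‖ ∧
          ∀ x : ℝ, 0 < x →
            μ.real {ω | x < GaussianPolynomial.centeredForm μ ξ A ω} ≤
              C₁ * Real.exp (-min (C₂ * x / ‖Matrix.toEuclideanCLM (𝕜 := ℝ) A‖)
                (C₂ * x ^ 2 / ∑ i, ∑ j, A i j ^ 2))) := by
  refine ⟨fun k hk => ⟨GaussianPolynomial.momentConst k ^ 2, Real.exp 1,
    (GaussianPolynomial.momentConst k ^ 2 * Real.exp 1)⁻¹, ?_, ?_, ?_,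
    fun μ _ ξ hξ hind a => ⟨fun M hM => ?_, fun x hx => ?_⟩⟩, ?_⟩
  · have := zero_lt_one.trans_le (GaussianPolynomial.one_le_momentConst hk)
    positivity
  · positivity
  · have := zero_lt_one.trans_le (GaussianPolynomial.one_le_momentConst hk)
    positivity
  · exact GaussianPolynomial.wickPolynomial_moment_le hk hξ hind a hM
  · exact GaussianPolynomial.wickPolynomial_tail_le_of_moment hk
      (one_le_pow₀ (GaussianPolynomial.one_le_momentConst hk)) a
      (fun M hM => GaussianPolynomial.wickPolynomial_moment_le hk hξ hind a hM) hx
  · have hC := GaussianPolynomial.one_le_momentConst (le_refl 2)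
    have hC0 := zero_lt_one.trans_le hC
    refine ⟨Real.exp 1, (GaussianPolynomial.momentConst 2 ^ 2 * Real.exp 1)⁻¹, by positivity,
      by positivity, fun μ _ n ξ hξ hind A _ => ?_⟩
    have hZ := GaussianPolynomial.wickPolynomial_matrixCoeff hξ hind A
    have h1 := GaussianPolynomial.V_one_matrixCoeff A
    have h2 := GaussianPolynomial.V_two_matrixCoeff A
    refine ⟨hZ, h1, h2, fun x hx => ?_⟩
    have h := GaussianPolynomial.wickPolynomial_tail_le_of_moment (le_refl 2) (one_le_pow₀ hC) _
      (fun M hM => GaussianPolynomial.wickPolynomial_moment_le (le_refl 2) hξ hind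
        (GaussianPolynomial.matrixCoeff A) hM) hx
    rw [hZ] at h
    have hsub : {ω | x < GaussianPolynomial.centeredForm μ ξ A ω} ⊆
        {ω | x < |GaussianPolynomial.centeredForm μ ξ A ω|} := fun ω hω => by
      rw [Set.mem_ofPred_eq] at hω ⊢
      exact hω.trans_le (le_abs_self _)
    refine (measureReal_mono hsub).trans (h.trans_eq ?_)
    have hI : Finset.Icc 2 2 = {2} := Finset.Icc_self 2
    -- For `k = s = 2` the exponents of `V̄_1`, `V̄_2` and of the quotient are `0`, `1` and `1`.
    simp only [hI, Finset.inf'_singleton]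
    rw [h1, h2, neg_mul, mul_min_of_nonneg _ _ (by positivity), min_comm]
    norm_num
    simp only [mul_div_assoc]
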